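/- Let $\mathbb F$ be a field of characteristic $0$, let $A$ be a differential algebra over $\mathbb F$ (a commutative associative unital algebra with a derivation $\partial$), let $E$ be a Lie conformal algebroid (LCAd) over $A$, with $\lambda$-bracket $[u_\lambda v]$ and anchor map $\theta$, and let $M$ be an $E$-module, with $\lambda$-action $u_\lambda m\in M[\lambda]$. For $k\ge 0$ let $C^k(E,M)$ be the space of $\mathbb F$-multilinear maps $\varphi_{\lambda_1,\dots,\lambda_k}:E^{k}\to M[\lambda_1,\dots,\lambda_k]/\langle\partial+\lambda_1+\dots+\lambda_k\rangle$ which are skewsymmetric under simultaneous permutations of the $u_i$ and the $\lambda_i$ and which satisfy, in every argument, $\varphi(\dots,\partial u_i,\dots)=-\lambda_i\,\varphi(\dots,u_i,\dots)$ and $\varphi_{\dots,\lambda_i,\dots}(\dots,a u_i,\dots)=\big(\big|_{x=\partial}a\big)\varphi_{\dots,\lambda_i+x,\dots}(\dots,u_i,\dots)$ for $a\in A$. Let $$(d\varphi)_{\lambda_1,\dots,\lambda_{k+1}}(u_1,\dots,u_{k+1})=\sum_{i}(-1)^{i+1}{u_i}_{\lambda_i}\big(\varphi_{\lambda_1,\stackrel{i}{\check\dots},\lambda_{k+1}}(u_1,\stackrel{i}{\check\dots},u_{k+1})\big)+\sum_{i<j}(-1)^{i+j}\varphi_{\lambda_i+\lambda_j,\lambda_1,\stackrel{i}{\check\dots}\stackrel{j}{\check\dots},\lambda_{k+1}}\big([{u_i}_{\lambda_i}u_j],u_1,\stackrel{i}{\check\dots}\stackrel{j}{\check\dots},u_{k+1}\big),$$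 and let $H^k(E,M)=\ker(d|_{C^k(E,M)})/\operatorname{im}(d|_{C^{k-1}(E,M)})$ be the LCAd cohomology. An $A[\partial]$-split abelian extension of $E$ by the $E$-module $M$ is a short exact sequence of LCAd homomorphisms $0\to M\stackrel{\iota}{\to}\widetilde E\stackrel{p}{\to}E\to0$, where $M$ has zero $\lambda$-bracket and zero anchor map, such that $p$ has a right inverse which is a homomorphism of left $A[\partial]$-modules, and such that $[x_\lambda\,\iota(m)]=\iota(p(x)_\lambda m)$ for all $x\in\widetilde E$, $m\in M$. Two such extensions are equivalent if there is an isomorphism of LCAd between them which induces the identity on $M$ and on $E$. An $\mathbb F$-bilinear map $\omega_\lambda:E\times E\to M[\lambda]$ is said to define an extension if the left $A[\partial]$-module $E\oplus M$, with the anchor map $u+m\mapsto\theta(u)$ and the $\lambda$-bracket $$[u+m\,{}_\lambda\, v+n]=[u_\lambda v]+\omega_\lambda(u,v)+u_\lambda n-\big(\big|_{x=\partial}v_{-\lambda-x}m\big),$$ is an LCAd; it is then an $A[\partial]$-split abelian extension $\widetilde E_\omega$ of $E$ by the $E$-module $M$. Such an extension is called trivial if it is equivalent to the one with $\omega=0$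 (the semidirect sum of $E$ and $M$). Then: (a) The maps $\omega$ that define an extension form a vector space, and $\omega\mapsto\varphi^\omega$, where $\varphi^\omega_{\lambda_1,\lambda_2}(u,v)$ is the class of $\omega_{\lambda_1}(u,v)$ in $M[\lambda_1,\lambda_2]/\langle\partial+\lambda_1+\lambda_2\rangle$, is a linear isomorphism from it onto $\ker(d|_{C^2(E,M)})$. (b) $\operatorname{im}(d|_{C^1(E,M)})\subseteq\ker(d|_{C^2(E,M)})$, and $\widetilde E_\omega$ is a trivial extension if and only if $\varphi^\omega\in\operatorname{im}(d|_{C^1(E,M)})$. (c) The second LCAd cohomology $H^2(E,M)$ classifies the $A[\partial]$-split abelian extensions of $E$ by the $E$-module $M$ up to equivalence: the assignment $[\varphi^\omega]\mapsto[\widetilde E_\omega]$ is a well defined bijection from $H^2(E,M)$ onto the set of equivalence classes of $A[\partial]$-split abelian extensions of $E$ by the $E$-module $M$. -/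

import Mathlib

open scoped Polynomial TensorProduct

set_option linter.unusedSectionVars false

namespace ConformalAlgebroid

noncomputable section

/-! ## Left modules over the algebra of differential operators -/

/-- Let `(A, δ)` be a differential algebra over `F`. A left `A[∂]`-module is an `A`-module `M`
with an `F`-linear operator `∂ = D δ` such that `∂ (a m) = δ(a) m + a ∂ m`. -/
class DiffModule {F A : Type*} [Field F] [CommRing A] [Algebra F A] (δ : Derivation F A A)
    (M : Type*) [AddCommGroup M] [Module F M] [Module A M] where
  /-- The action of `∂`. -/
  D (δ) : M →ₗ[F] M
  D_smul : ∀ (a : A) (m : M), D (a • m) = δ a • m + a • D m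

open DiffModule

/-- The direct sum of two left `A[∂]`-modules. -/
instance prodDiffModule {F A : Type*} [Field F] [CommRing A] [Algebra F A]
    (δ : Derivation F A A) (M N : Type*)
    [AddCommGroup M] [Module F M] [Module A M] [DiffModule δ M]
    [AddCommGroup N] [Module F N] [Module A N] [DiffModule δ N] : DiffModule δ (M × N) where
  D := (D δ (M := M)).prodMap (D δ (M := N))
  D_smul := by
    rintro a ⟨m, n⟩
    simp [D_smul]

/-- A differential algebra as a left module over its differential operators. -/
instance selfDiffModule {F A : Type*} [Field F] [CommRing A] [Algebra F A]
    (δ : Derivation F A A) : DiffModule δ A where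
  D := δ.toLinearMap
  D_smul := by
    intro a m
    simp only [Derivation.coeFn_coe, smul_eq_mul, Derivation.leibniz]
    ring

/-! ## Polynomials with coefficients in a module

For a commutative polynomial algebra `P` over `F`, the space of polynomials with coefficients in
`M` is `P ⊗[F] M`. In particular `M[λ]` is `F[X] ⊗[F] M`. -/

section Polynomials

variable {F : Type*} [Field F] {A : Type*} [CommRing A] [Algebra F A] (δ : Derivation F A A)
  {P : Type*} [CommRing P] [Algebra F P]
  {M : Type*} [AddCommGroup M] [Module F M]
  {N : Type*} [AddCommGroup N] [Module F N]

/-- Substitution of `ℓ ∈ P` for `λ`: the map `M[λ] → P ⊗ M`, `f_λ ↦ f_ℓ`. -/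
def subst (ℓ : P) : F[X] ⊗[F] M →ₗ[F] P ⊗[F] M :=
  (Polynomial.aeval ℓ).toLinearMap.rTensor M

/-- For `g_λ : M → N[λ]`, the `P`-linear map `g_ℓ : P ⊗ M → P ⊗ N`, `p ⊗ m ↦ p g_ℓ(m)`. -/
def applyAt (ℓ : P) (g : M →ₗ[F] F[X] ⊗[F] N) : P ⊗[F] M →ₗ[P] P ⊗[F] N :=
  LinearMap.liftBaseChange P (subst ℓ ∘ₗ g)

/-- The action of `a ∈ A` on coefficients. -/
def coeffSMul [Module A M] [IsScalarTower F A M] (a : A) : P ⊗[F] M →ₗ[F] P ⊗[F] M :=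
  (Algebra.lsmul F F M a).lTensor P

/-- Multiplication of a polynomial with coefficients in `A` by `m ∈ M`. -/
def coeffMul [Module A M] [IsScalarTower F A M] (m : M) : P ⊗[F] A →ₗ[F] P ⊗[F] M :=
  ((LinearMap.toSpanSingleton A M m).restrictScalars F).lTensor P

/-- The action of `∂ + ℓ` on `P ⊗ M`, with `∂` acting on coefficients. -/
def dPlus [Module A M] [DiffModule δ M] (ℓ : P) : P ⊗[F] M →ₗ[P] P ⊗[F] M :=
  (D δ (M := M)).baseChange P + ℓ • LinearMap.id

/-- `f_λ ↦ (|_{x=∂} f_{-λ-x})`: replace `λ` by `-λ-∂`, with `∂` acting on coefficients. -/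
def adj [Module A M] [DiffModule δ M] : F[X] ⊗[F] M →ₗ[F] F[X] ⊗[F] M :=
  TensorProduct.lift
    ((LinearMap.lcomp F (F[X] ⊗[F] M) (TensorProduct.mk F F[X] M 1)) ∘ₗ
      (Polynomial.aeval
        (-((dPlus δ (Polynomial.X : F[X]) (M := M)).restrictScalars F))).toLinearMap)

/-- Given an algebra homomorphism `s : P → P[x]` and `a ∈ A`, the map
`p ⊗ m ↦ ∑ₙ cₙ ⊗ δⁿ(a) m`, where `s(p) = ∑ₙ cₙ xⁿ`. In other words `x` is replaced by `∂`
acting on `a` only. -/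
def shiftSMul [Module A M] [IsScalarTower F A M] (s : P →ₐ[F] P[X]) (a : A) :
    P ⊗[F] M →ₗ[F] P ⊗[F] M :=
  TensorProduct.lift
    (Polynomial.lsum (fun n =>
        (TensorProduct.mk F P M).compl₂ (Algebra.lsmul F F M (δ^[n] a))) ∘ₗ s.toLinearMap)

/-- `f_λ ↦ (|_{x=∂} a) f_{λ+x}` on `M[λ]`. -/
def shift₁ [Module A M] [IsScalarTower F A M] (a : A) : F[X] ⊗[F] M →ₗ[F] F[X] ⊗[F] M :=
  shiftSMul δ (Polynomial.aeval (Polynomial.C Polynomial.X + Polynomial.X)) a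

end Polynomials

/-! ## Conformal derivations, Lie conformal algebroids and their modules -/

section Algebroids

variable {F : Type*} [Field F] {A : Type*} [CommRing A] [Algebra F A] (δ : Derivation F A A)

/-- The space of (left) conformal derivations of the differential algebra `A`. -/
def CDer : Submodule F (A →ₗ[F] F[X] ⊗[F] A) where
  carrier := {φ | (∀ a : A, φ (δ a) = dPlus δ Polynomial.X (φ a)) ∧
    ∀ a b : A, φ (a * b) = coeffSMul b (φ a) + coeffSMul a (φ b)}
  add_mem' := by
    rintro φ ψ ⟨h1, h2⟩ ⟨h3, h4⟩
    refine ⟨fun a => by simp [h1, h3], fun a b => ?_⟩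
    simp only [LinearMap.add_apply, h2, h4, map_add]
    abel
  zero_mem' := by simp
  smul_mem' := by
    rintro c φ ⟨h1, h2⟩
    refine ⟨fun a => ?_, fun a b => by simp [h2]⟩
    have h := ((dPlus δ (Polynomial.X : F[X]) (M := A)).restrictScalars F).map_smul c (φ a)
    simp only [LinearMap.coe_restrictScalars] at h
    rw [LinearMap.smul_apply, LinearMap.smul_apply, h, h1]

/-- The axioms of a Lie conformal algebroid, for a `λ`-bracket and an anchor map on a left
`A[∂]`-module `E`. Conditions on the action of a differential operator `a(∂)` are stated for the
generators `a ∈ A` and `∂` of `A[∂]`. Identities in two variables live in polynomials in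
`λ = X 0` and `μ = X 1`. -/
structure IsLCAd {E : Type*} [AddCommGroup E] [Module F E] [Module A E] [IsScalarTower F A E]
    [DiffModule δ E] (bracket : E →ₗ[F] E →ₗ[F] F[X] ⊗[F] E) (anchor : E →ₗ[F] CDer δ) :
    Prop where
  /-- `θ(a u)_λ = (|_{x=∂} a) θ(u)_{λ+x}`. -/
  anchor_smul : ∀ (a : A) (u : E) (b : A),
    (anchor (a • u)).1 b = shift₁ δ a ((anchor u).1 b)
  /-- `θ(∂u)_λ = -λ θ(u)_λ`. -/
  anchor_D : ∀ (u : E) (b : A),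
    (anchor (D δ u)).1 b = -((Polynomial.X : F[X]) • (anchor u).1 b)
  /-- `[∂u_λ v] = -λ [u_λ v]`. -/
  bracket_D_left : ∀ u v : E, bracket (D δ u) v = -((Polynomial.X : F[X]) • bracket u v)
  /-- `[u_λ ∂v] = (∂+λ) [u_λ v]`. -/
  bracket_D_right : ∀ u v : E, bracket u (D δ v) = dPlus δ Polynomial.X (bracket u v)
  /-- `[v_λ u] = -(|_{x=∂} [u_{-λ-x} v])`. -/
  skew : ∀ u v : E, bracket v u = -(adj δ (bracket u v))
  /-- `[u_λ [v_μ w]] - [v_μ [u_λ w]] = [[u_λ v]_{λ+μ} w]`. -/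
  jacobi : ∀ u v w : E,
    applyAt (MvPolynomial.X 0 : MvPolynomial (Fin 2) F) (bracket u)
        (subst (MvPolynomial.X 1) (bracket v w))
      - applyAt (MvPolynomial.X 1 : MvPolynomial (Fin 2) F) (bracket v)
        (subst (MvPolynomial.X 0) (bracket u w))
      = applyAt (MvPolynomial.X 0 + MvPolynomial.X 1 : MvPolynomial (Fin 2) F) (bracket.flip w)
        (subst (MvPolynomial.X 0) (bracket u v))
  /-- `[u_λ a v] = a [u_λ v] + θ(u)_λ(a) v`. -/
  bracket_smul : ∀ (u : E) (a : A) (v : E),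
    bracket u (a • v) = coeffSMul a (bracket u v) + coeffMul v ((anchor u).1 a)
  /-- `θ([u_λ v])_μ(a) = θ(u)_λ(θ(v)_{μ-λ}(a)) - θ(v)_{μ-λ}(θ(u)_λ(a))`. -/
  anchor_bracket : ∀ (u v : E) (a : A),
    applyAt (MvPolynomial.X 1 : MvPolynomial (Fin 2) F)
        ((LinearMap.applyₗ a) ∘ₗ (CDer δ).subtype ∘ₗ anchor)
        (subst (MvPolynomial.X 0) (bracket u v))
      = applyAt (MvPolynomial.X 0 : MvPolynomial (Fin 2) F) (anchor u).1
          (subst (MvPolynomial.X 1 - MvPolynomial.X 0) ((anchor v).1 a))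
        - applyAt (MvPolynomial.X 1 - MvPolynomial.X 0 : MvPolynomial (Fin 2) F) (anchor v).1
          (subst (MvPolynomial.X 0) ((anchor u).1 a))

/-- A Lie conformal algebroid structure over `(A, δ)` on the left `A[∂]`-module `E`. -/
structure LCAd (E : Type*) [AddCommGroup E] [Module F E] [Module A E] [IsScalarTower F A E]
    [DiffModule δ E] where
  /-- The `λ`-bracket. -/
  bracket : E →ₗ[F] E →ₗ[F] F[X] ⊗[F] E
  /-- The anchor map. -/
  anchor : E →ₗ[F] CDer δ
  isLCAd : IsLCAd δ bracket anchor

/-- A left `A[∂]`-module viewed as an abelian Lie conformal algebroid. -/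
def abelianLCAd (M : Type*) [AddCommGroup M] [Module F M] [Module A M] [IsScalarTower F A M]
    [DiffModule δ M] : LCAd δ M where
  bracket := 0
  anchor := 0
  isLCAd := by
    constructor <;> intros <;> simp [applyAt]

variable {δ}

/-- A homomorphism of Lie conformal algebroids over `A`. -/
structure LCAdHom {E₁ E₂ : Type*}
    [AddCommGroup E₁] [Module F E₁] [Module A E₁] [IsScalarTower F A E₁] [DiffModule δ E₁]
    [AddCommGroup E₂] [Module F E₂] [Module A E₂] [IsScalarTower F A E₂] [DiffModule δ E₂]
    (L₁ : LCAd δ E₁) (L₂ : LCAd δ E₂) extends E₁ →ₗ[A] E₂ where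
  map_D : ∀ u : E₁, toFun (D δ u) = D δ (toFun u)
  map_bracket : ∀ u v : E₁, L₂.bracket (toFun u) (toFun v)
    = (toLinearMap.restrictScalars F).lTensor F[X] (L₁.bracket u v)
  map_anchor : ∀ u : E₁, L₂.anchor (toFun u) = L₁.anchor u

/-- A module structure on the left `A[∂]`-module `M` over the Lie conformal algebroid `E`. -/
structure LCAdModule {E : Type*}
    [AddCommGroup E] [Module F E] [Module A E] [IsScalarTower F A E] [DiffModule δ E]
    (L : LCAd δ E) (M : Type*)
    [AddCommGroup M] [Module F M] [Module A M] [IsScalarTower F A M] [DiffModule δ M] where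
  /-- The `λ`-action. -/
  act : E →ₗ[F] M →ₗ[F] F[X] ⊗[F] M
  /-- `u_λ (a m) = a (u_λ m) + θ(u)_λ(a) m`. -/
  act_smul : ∀ (u : E) (a : A) (m : M),
    act u (a • m) = coeffSMul a (act u m) + coeffMul m ((L.anchor u).1 a)
  /-- `u_λ (∂m) = (∂+λ) (u_λ m)`. -/
  act_D : ∀ (u : E) (m : M), act u (D δ m) = dPlus δ Polynomial.X (act u m)
  /-- `(a u)_λ m = (|_{x=∂} a) (u_{λ+x} m)`. -/
  smul_act : ∀ (a : A) (u : E) (m : M), act (a • u) m = shift₁ δ a (act u m)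
  /-- `(∂u)_λ m = -λ (u_λ m)`. -/
  D_act : ∀ (u : E) (m : M), act (D δ u) m = -((Polynomial.X : F[X]) • act u m)
  /-- `[u_λ v]_μ m = u_λ (v_{μ-λ} m) - v_{μ-λ} (u_λ m)`. -/
  bracket_act : ∀ (u v : E) (m : M),
    applyAt (MvPolynomial.X 1 : MvPolynomial (Fin 2) F) (act.flip m)
        (subst (MvPolynomial.X 0) (L.bracket u v))
      = applyAt (MvPolynomial.X 0 : MvPolynomial (Fin 2) F) (act u)
          (subst (MvPolynomial.X 1 - MvPolynomial.X 0) (act v m))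
        - applyAt (MvPolynomial.X 1 - MvPolynomial.X 0 : MvPolynomial (Fin 2) F) (act v)
          (subst (MvPolynomial.X 0) (act u m))

end Algebroids

/-! ## The cohomology complex -/

section Cohomology

variable {F : Type*} [Field F] {A : Type*} [CommRing A] [Algebra F A] (δ : Derivation F A A)
  (M : Type*) [AddCommGroup M] [Module F M] [Module A M] [DiffModule δ M]

/-- `λ₁ + ⋯ + λ_k`. -/
def lamSum (F : Type*) [Field F] (k : ℕ) : MvPolynomial (Fin k) F := ∑ i, MvPolynomial.X i

/-- The space `M[λ₁, …, λ_k] / ⟨∂ + λ₁ + ⋯ + λ_k⟩`. -/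
def Values (k : ℕ) : Type _ :=
  (MvPolynomial (Fin k) F ⊗[F] M) ⧸
    LinearMap.range ((dPlus δ (lamSum F k) (M := M)).restrictScalars F)

instance (k : ℕ) : AddCommGroup (Values δ M k) :=
  inferInstanceAs (AddCommGroup ((MvPolynomial (Fin k) F ⊗[F] M) ⧸
    LinearMap.range ((dPlus δ (lamSum F k) (M := M)).restrictScalars F)))

instance (k : ℕ) : Module F (Values δ M k) :=
  inferInstanceAs (Module F ((MvPolynomial (Fin k) F ⊗[F] M) ⧸
    LinearMap.range ((dPlus δ (lamSum F k) (M := M)).restrictScalars F)))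

/-- The canonical quotient map. -/
def toValues (k : ℕ) : MvPolynomial (Fin k) F ⊗[F] M →ₗ[F] Values δ M k :=
  Submodule.mkQ (LinearMap.range ((dPlus δ (lamSum F k) (M := M)).restrictScalars F))

theorem toValues_surjective (k : ℕ) : Function.Surjective (toValues δ M k) :=
  Submodule.mkQ_surjective _

variable {M}

/-- The map on quotients induced by a linear map of polynomial spaces. -/
def descend {k l : ℕ} (T : MvPolynomial (Fin k) F ⊗[F] M →ₗ[F] MvPolynomial (Fin l) F ⊗[F] M)
    (hT : ∀ x, T (dPlus δ (lamSum F k) x) ∈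
      LinearMap.range ((dPlus δ (lamSum F l) (M := M)).restrictScalars F)) :
    Values δ M k →ₗ[F] Values δ M l :=
  Submodule.mapQ (LinearMap.range ((dPlus δ (lamSum F k) (M := M)).restrictScalars F))
    (LinearMap.range ((dPlus δ (lamSum F l) (M := M)).restrictScalars F)) T
    (by rintro _ ⟨x, rfl⟩; exact hT x)

theorem descend_toValues {k l : ℕ}
    (T : MvPolynomial (Fin k) F ⊗[F] M →ₗ[F] MvPolynomial (Fin l) F ⊗[F] M)
    (hT : ∀ x, T (dPlus δ (lamSum F k) x) ∈
      LinearMap.range ((dPlus δ (lamSum F l) (M := M)).restrictScalars F))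
    (x : MvPolynomial (Fin k) F ⊗[F] M) :
    descend δ T hT (toValues δ M k x) = toValues δ M l (T x) := rfl

theorem dPlus_tmul {P : Type*} [CommRing P] [Algebra F P] (ℓ p : P) (m : M) :
    dPlus δ ℓ (p ⊗ₜ[F] m) = p ⊗ₜ[F] D δ m + (ℓ * p) ⊗ₜ[F] m := by
  simp [dPlus, TensorProduct.smul_tmul']

/-- The map on quotients induced by a substitution of variables that preserves their sum. -/
def substValues {k l : ℕ} (s : MvPolynomial (Fin k) F →ₐ[F] MvPolynomial (Fin l) F)
    (hs : s (lamSum F k) = lamSum F l) : Values δ M k →ₗ[F] Values δ M l :=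
  descend δ (s.toLinearMap.rTensor M) (by
    intro x
    refine ⟨s.toLinearMap.rTensor M x, ?_⟩
    induction x with
    | zero => simp
    | add x y hx hy => simp_all
    | tmul p m => simp [dPlus_tmul, hs])

/-- Permutation of the variables: `f_{λ₁, …, λ_k} ↦ f_{λ_{π(1)}, …, λ_{π(k)}}`. -/
def permValues {k : ℕ} (π : Equiv.Perm (Fin k)) : Values δ M k →ₗ[F] Values δ M k :=
  substValues δ (MvPolynomial.rename π) (by
    simp only [lamSum, map_sum, MvPolynomial.rename_X]
    exact Equiv.sum_comp π (fun i => (MvPolynomial.X i : MvPolynomial (Fin k) F)))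

/-- Multiplication by polynomials on `M[λ₁, …, λ_k] / ⟨∂ + λ₁ + ⋯ + λ_k⟩`. -/
def mulValues (k : ℕ) :
    MvPolynomial (Fin k) F →ₗ[F] Values δ M k →ₗ[F] Values δ M k where
  toFun p := descend δ (LinearMap.lsmul (MvPolynomial (Fin k) F)
      (MvPolynomial (Fin k) F ⊗[F] M) p |>.restrictScalars F) (fun x => ⟨p • x, by simp⟩)
  map_add' p q := by
    ext x
    obtain ⟨x, rfl⟩ := toValues_surjective δ M k x
    exact (congrArg (toValues δ M k) (add_smul p q x)).trans
      (map_add (toValues δ M k) (p • x) (q • x))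
  map_smul' c p := by
    ext x
    obtain ⟨x, rfl⟩ := toValues_surjective δ M k x
    exact (congrArg (toValues δ M k) (smul_assoc c p x)).trans
      (map_smul (toValues δ M k) c (p • x))

/-- The operator `f_{λ₁, …, λ_k} ↦ (|_{x=∂} a) f_{λ₁, …, λ_i + x, …, λ_k}`. -/
def shiftPoly [IsScalarTower F A M] {k : ℕ} (i : Fin k) (a : A) :
    MvPolynomial (Fin k) F ⊗[F] M →ₗ[F] MvPolynomial (Fin k) F ⊗[F] M :=
  shiftSMul δ (MvPolynomial.aeval fun j =>
    Polynomial.C (MvPolynomial.X j) + if j = i then Polynomial.X else 0) a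

theorem shiftPoly_dPlus [IsScalarTower F A M] {k : ℕ} (i : Fin k) (a : A)
    (x : MvPolynomial (Fin k) F ⊗[F] M) :
    shiftPoly δ i a (dPlus δ (lamSum F k) x) = dPlus δ (lamSum F k) (shiftPoly δ i a x) := by
  induction x with
  | zero => simp
  | add x y hx hy => simp_all
  | tmul p m =>
    have key : ∀ (n : ℕ) (b : A), δ (δ^[n] b) = δ^[n + 1] b := fun n b =>
      (Function.iterate_succ_apply' δ n b).symm
    have hs : (MvPolynomial.aeval fun j => (Polynomial.C (MvPolynomial.X j) +
        if j = i then Polynomial.X else 0 : (MvPolynomial (Fin k) F)[X])) (lamSum F k)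
        = Polynomial.C (lamSum F k) + Polynomial.X := by
      simp [lamSum, Finset.sum_add_distrib]
    simp only [shiftPoly, shiftSMul, dPlus_tmul, map_add, TensorProduct.lift.tmul,
      LinearMap.comp_apply, AlgHom.toLinearMap_apply, map_mul, hs]
    generalize (MvPolynomial.aeval fun j => (Polynomial.C (MvPolynomial.X j) +
        if j = i then Polynomial.X else 0 : (MvPolynomial (Fin k) F)[X])) p = q
    induction q using Polynomial.induction_on' with
    | add q r hq hr =>
      simp only [mul_add, map_add, LinearMap.add_apply] at hq hr ⊢
      rw [← hq, ← hr]
      abel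
    | monomial n c =>
      simp only [add_mul, Polynomial.C_mul_monomial, Polynomial.X_mul_monomial, map_add,
        LinearMap.add_apply, Polynomial.lsum_apply]
      simp [dPlus_tmul, D_smul, TensorProduct.tmul_add, ← key]
      abel

/-- The operator `f_{λ₁, …, λ_k} ↦ (|_{x=∂} a) f_{λ₁, …, λ_i + x, …, λ_k}` on the quotient. -/
def shiftValues [IsScalarTower F A M] {k : ℕ} (i : Fin k) (a : A) :
    Values δ M k →ₗ[F] Values δ M k :=
  descend δ (shiftPoly δ i a) (fun x => ⟨shiftPoly δ i a x, (shiftPoly_dPlus δ i a x).symm⟩)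

section Differential

variable {E : Type*} [AddCommGroup E] [Module F E] [Module A E] [IsScalarTower F A E]
  [DiffModule δ E]

/-- The space `C^k(E, M)` of `k`-cochains. -/
def cochains (E M : Type*) [AddCommGroup E] [Module F E] [Module A E] [DiffModule δ E]
    [AddCommGroup M] [Module F M] [Module A M] [IsScalarTower F A M] [DiffModule δ M] (k : ℕ) :
    Submodule F (MultilinearMap F (fun _ : Fin k => E) (Values δ M k)) where
  carrier := {φ |
    (∀ (u : Fin k → E) (i : Fin k) (a : A),
      φ (Function.update u i (a • u i)) = shiftValues δ i a (φ u)) ∧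
    (∀ (u : Fin k → E) (i : Fin k),
      φ (Function.update u i (D δ (u i))) = -(mulValues δ k (MvPolynomial.X i) (φ u))) ∧
    (∀ (u : Fin k → E) (π : Equiv.Perm (Fin k)),
      φ u = (Equiv.Perm.sign π : ℤ) • permValues δ π (φ (u ∘ π)))}
  add_mem' := by
    rintro φ ψ ⟨h1, h2, h3⟩ ⟨h4, h5, h6⟩
    refine ⟨fun u i a => by simp [h1, h4], fun u i => ?_, fun u π => ?_⟩
    · simp only [add_apply, h2, h5, map_add, neg_add]
    · simp only [add_apply, map_add, smul_add]
      rw [← h3, ← h6]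
  zero_mem' := by simp
  smul_mem' := by
    rintro c φ ⟨h1, h2, h3⟩
    refine ⟨fun u i a => by simp [h1], fun u i => by simp [h2], fun u π => ?_⟩
    simp only [smul_apply, map_smul]
    rw [smul_comm, ← h3]

variable {δ} [IsScalarTower F A M] {L : LCAd δ E} (R : LCAdModule L M)

theorem subst_dPlus {P : Type*} [CommRing P] [Algebra F P] (ℓ : P) (f : F[X] ⊗[F] M) :
    subst ℓ (dPlus δ Polynomial.X f) = dPlus δ ℓ (subst ℓ f) := by
  induction f with
  | zero => simp
  | add x y hx hy => simp_all
  | tmul p m => simp [dPlus_tmul, subst]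

theorem act_dPlus {k : ℕ} (i : Fin (k + 1)) (u : E) (x : MvPolynomial (Fin k) F ⊗[F] M) :
    ((applyAt (MvPolynomial.X i : MvPolynomial (Fin (k + 1)) F) (R.act u)).restrictScalars F ∘ₗ
      (MvPolynomial.rename (R := F) i.succAbove).toLinearMap.rTensor M)
        (dPlus δ (lamSum F k) x)
      = dPlus δ (lamSum F (k + 1))
        (((applyAt (MvPolynomial.X i : MvPolynomial (Fin (k + 1)) F)
          (R.act u)).restrictScalars F ∘ₗ
          (MvPolynomial.rename (R := F) i.succAbove).toLinearMap.rTensor M) x) := by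
  induction x with
  | zero => simp
  | add x y hx hy => simp only [map_add, hx, hy]
  | tmul p m =>
    have h : (lamSum F (k + 1) : MvPolynomial (Fin (k + 1)) F)
        = MvPolynomial.X i + MvPolynomial.rename i.succAbove (lamSum F k) := by
      simp [lamSum, Fin.sum_univ_succAbove _ i]
    simp only [dPlus_tmul, LinearMap.comp_apply, map_add, LinearMap.rTensor_tmul,
      AlgHom.toLinearMap_apply, map_mul, LinearMap.coe_restrictScalars, applyAt,
      LinearMap.liftBaseChange_tmul, R.act_D, subst_dPlus, map_smul, h]
    simp only [dPlus, LinearMap.add_apply, LinearMap.smul_apply, LinearMap.id_apply, add_smul,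
      smul_add, mul_smul]
    rw [smul_comm (MvPolynomial.rename i.succAbove p) (MvPolynomial.X i : MvPolynomial _ F),
      smul_comm (MvPolynomial.rename i.succAbove p) (MvPolynomial.rename i.succAbove (lamSum F k))]
    abel

/-- For `u ∈ E`, the map `f_{λ₁, …, λ_k} ↦ u_{λ_i} (f_{λ₁, …, λ_{k+1}})` with `λ_i` omitted in
`f`. -/
def actValues {k : ℕ} (i : Fin (k + 1)) : E →ₗ[F] Values δ M k →ₗ[F] Values δ M (k + 1) where
  toFun u := descend δ
    (((applyAt (MvPolynomial.X i : MvPolynomial (Fin (k + 1)) F) (R.act u)).restrictScalars F) ∘ₗ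
      (MvPolynomial.rename (R := F) i.succAbove).toLinearMap.rTensor M)
    (fun x => ⟨_, (act_dPlus R i u x).symm⟩)
  map_add' u v := by
    ext x
    obtain ⟨x, rfl⟩ := toValues_surjective δ M k x
    refine (congrArg (toValues δ M (k + 1)) ?_).trans (map_add (toValues δ M (k + 1)) _ _)
    induction x with
    | zero => simp
    | add x y hx hy =>
      simp only [map_add] at hx hy ⊢
      simp only [hx, hy]
      abel
    | tmul p m => simp [applyAt, LinearMap.comp_add]
  map_smul' c u := by
    ext x
    obtain ⟨x, rfl⟩ := toValues_surjective δ M k x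
    refine (congrArg (toValues δ M (k + 1)) ?_).trans (map_smul (toValues δ M (k + 1)) _ _)
    induction x with
    | zero => simp
    | add x y hx hy => simp only [map_add, hx, hy, smul_add]
    | tmul p m => simp [applyAt, smul_comm c]

/-- The map `f_{λ₁, …, λ_{k+1}} ↦ f_{λ_i + λ_j, λ₁, …, λ_{k+2}}` with `λ_i` and `λ_j` omitted
from the sequence `λ₁, …, λ_{k+2}`, for `i < j`. Here `i` is given as an element of
`Fin (k + 1)`, the index set with `j` removed. -/
def mergeValues {k : ℕ} (j : Fin (k + 2)) (i : Fin (k + 1)) :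
    Values δ M (k + 1) →ₗ[F] Values δ M (k + 2) :=
  substValues δ (MvPolynomial.aeval (Fin.cons
      (MvPolynomial.X (j.succAbove i) + MvPolynomial.X j)
      (fun l : Fin k => MvPolynomial.X (j.succAbove (i.succAbove l))))) (by
    simp only [lamSum, map_sum, MvPolynomial.aeval_X]
    rw [Fin.sum_univ_succ, Fin.sum_univ_succAbove _ j, Fin.sum_univ_succAbove _ i]
    simp only [Fin.cons_zero, Fin.cons_succ]
    abel)

/-- The first part of the differential:
`∑_i (-1)^{i+1} u_i _{λ_i} (φ_{λ₁, …, λ_{k+1}}(u₁, …, u_{k+1}))`, with `i` omitted in `φ`. -/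
def dAct (k : ℕ) : MultilinearMap F (fun _ : Fin k => E) (Values δ M k) →ₗ[F]
    MultilinearMap F (fun _ : Fin (k + 1) => E) (Values δ M (k + 1)) :=
  ∑ i : Fin (k + 1), (-1 : ℤ) ^ (i : ℕ) •
    { toFun := fun φ => LinearMap.uncurryMid (M := fun _ => E) i
        { toFun := fun x => (actValues R i x).compMultilinearMap φ
          map_add' := by intros; ext; simp
          map_smul' := by intros; ext; simp }
      map_add' := by intros; ext; simp
      map_smul' := by intros; ext; simp }

/-- For `c_λ ∈ E[λ]`, the expression
`φ_{λ_i + λ_j, λ₁, …, λ_{k+2}}(c_{λ_i}, w₁, …, w_k)` with `λ_i` and `λ_j` omitted from the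
sequence `λ₁, …, λ_{k+2}`. -/
def insertBracket {k : ℕ} (j : Fin (k + 2)) (i : Fin (k + 1))
    (φ : MultilinearMap F (fun _ : Fin (k + 1) => E) (Values δ M (k + 1))) :
    F[X] ⊗[F] E →ₗ[F] MultilinearMap F (fun _ : Fin k => E) (Values δ M (k + 2)) :=
  TensorProduct.lift (LinearMap.mk₂ F
    (fun (p : F[X]) (c : E) =>
      (mulValues δ (k + 2) (Polynomial.aeval (MvPolynomial.X (j.succAbove i)) p) ∘ₗ
        mergeValues j i).compMultilinearMap (φ.curryLeft c))
    (by intros; ext; simp) (by intros; ext; simp) (by intros; ext; simp)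
    (by intros; ext; simp))

theorem insertBracket_add {k : ℕ} (j : Fin (k + 2)) (i : Fin (k + 1))
    (φ ψ : MultilinearMap F (fun _ : Fin (k + 1) => E) (Values δ M (k + 1))) :
    insertBracket j i (φ + ψ) = insertBracket j i φ + insertBracket j i ψ := by
  apply TensorProduct.ext'
  intro p c
  ext w
  simp [insertBracket]

theorem insertBracket_smul {k : ℕ} (j : Fin (k + 2)) (i : Fin (k + 1)) (c : F)
    (φ : MultilinearMap F (fun _ : Fin (k + 1) => E) (Values δ M (k + 1))) :
    insertBracket j i (c • φ) = c • insertBracket j i φ := by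
  apply TensorProduct.ext'
  intro p c
  ext w
  simp [insertBracket]

/-- The second part of the differential:
`∑_{i<j} (-1)^{i+j} φ_{λ_i + λ_j, λ₁, …, λ_{k+2}}([u_i _{λ_i} u_j], u₁, …, u_{k+2})`, with
`i` and `j` omitted in the sequences `λ₁, …, λ_{k+2}` and `u₁, …, u_{k+2}`. -/
def dBracket (L : LCAd δ E) (k : ℕ) :
    MultilinearMap F (fun _ : Fin (k + 1) => E) (Values δ M (k + 1)) →ₗ[F]
    MultilinearMap F (fun _ : Fin (k + 2) => E) (Values δ M (k + 2)) :=
  ∑ j : Fin (k + 2), ∑ i : Fin (k + 1), if i.castSucc < j then (-1 : ℤ) ^ ((i : ℕ) + (j : ℕ)) •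
    { toFun := fun φ => LinearMap.uncurryMid (M := fun _ => E) j
        { toFun := fun v => LinearMap.uncurryMid (M := fun _ => E) i
            (insertBracket j i φ ∘ₗ L.bracket.flip v)
          map_add' := by intros; ext; simp
          map_smul' := by intros; ext; simp }
      map_add' := by intros; ext; simp [insertBracket_add]
      map_smul' := by intros; ext; simp [insertBracket_smul] } else 0

/-- The differential. -/
def d : (k : ℕ) → MultilinearMap F (fun _ : Fin k => E) (Values δ M k) →ₗ[F]
    MultilinearMap F (fun _ : Fin (k + 1) => E) (Values δ M (k + 1))
  | 0 => dAct R 0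
  | k + 1 => dAct R (k + 1) + dBracket L k

/-- The space of `k`-cocycles: the kernel of `d` on `C^k(E, M)`. -/
def cocycles (k : ℕ) : Submodule F (MultilinearMap F (fun _ : Fin k => E) (Values δ M k)) :=
  cochains δ E M k ⊓ LinearMap.ker (d R k)

/-- The space of `k`-coboundaries: the image under `d` of `C^{k-1}(E, M)`. -/
def coboundaries :
    (k : ℕ) → Submodule F (MultilinearMap F (fun _ : Fin k => E) (Values δ M k))
  | 0 => ⊥
  | k + 1 => (cochains δ E M k).map (d R k)

/-- The cohomology `H^k(E, M)`. -/
abbrev cohomology (k : ℕ) : Type _ :=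
  cocycles R k ⧸ (coboundaries R k).submoduleOf (cocycles R k)

end Differential

end Cohomology

/-! ## Abelian extensions -/

section Extensions

universe uF uA uE uM

variable {F : Type uF} [Field F] {A : Type uA} [CommRing A] [Algebra F A] {δ : Derivation F A A}
  {E : Type uE} [AddCommGroup E] [Module F E] [Module A E] [IsScalarTower F A E] [DiffModule δ E]
  {M : Type uM} [AddCommGroup M] [Module F M] [Module A M] [IsScalarTower F A M]
  [DiffModule δ M]

/-- An abelian extension `0 → M → Ẽ → E → 0` of the Lie conformal algebroid `E` by the left
`A[∂]`-module `M`. -/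
structure AbExt (L : LCAd δ E) (M : Type uM) [AddCommGroup M] [Module F M] [Module A M]
    [IsScalarTower F A M] [DiffModule δ M] : Type (max uF uA (uE + 1) (uM + 1)) where
  /-- The space `Ẽ`. -/
  carrier : Type (max uE uM)
  [addCommGroup : AddCommGroup carrier]
  [moduleF : Module F carrier]
  [moduleA : Module A carrier]
  [isScalarTower : IsScalarTower F A carrier]
  [diffModule : DiffModule δ carrier]
  /-- The Lie conformal algebroid structure of `Ẽ`. -/
  lcad : LCAd δ carrier
  /-- The map `M → Ẽ`. -/
  ι : LCAdHom (abelianLCAd δ M) lcad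
  /-- The map `Ẽ → E`. -/
  p : LCAdHom lcad L
  ι_injective : Function.Injective ι.toLinearMap
  p_surjective : Function.Surjective p.toLinearMap
  exact : Function.Exact ι.toLinearMap p.toLinearMap

attribute [instance] AbExt.addCommGroup AbExt.moduleF AbExt.moduleA AbExt.isScalarTower
  AbExt.diffModule

variable {L : LCAd δ E}

/-- The extension is `A[∂]`-split: `p` has a right inverse that is a homomorphism of left
`A[∂]`-modules. -/
def AbExt.IsSplit (X : AbExt L M) : Prop :=
  ∃ j : E →ₗ[A] X.carrier, (∀ u, j (D δ u) = D δ (j u)) ∧ ∀ u, X.p.toLinearMap (j u) = u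

/-- The extension is an extension by the `E`-module `M`: the `λ`-bracket of `Ẽ` with elements
of `M` is the given `λ`-action of `E` on `M`. -/
def AbExt.InducesAction (X : AbExt L M) (R : LCAdModule L M) : Prop :=
  ∀ (x : X.carrier) (m : M), X.lcad.bracket x (X.ι.toLinearMap m)
    = (X.ι.toLinearMap.restrictScalars F).lTensor F[X] (R.act (X.p.toLinearMap x) m)

/-- Two abelian extensions are equivalent if there is an isomorphism of Lie conformal algebroids
between them that is the identity on `M` and on `E`. -/
def AbExt.Equivalent (X Y : AbExt L M) : Prop :=
  ∃ χ : LCAdHom X.lcad Y.lcad, Function.Bijective χ.toLinearMap ∧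
    (∀ m, χ.toLinearMap (X.ι.toLinearMap m) = Y.ι.toLinearMap m) ∧
    (∀ x, Y.p.toLinearMap (χ.toLinearMap x) = X.p.toLinearMap x)

theorem AbExt.Equivalent.refl (X : AbExt L M) : X.Equivalent X :=
  ⟨{ toLinearMap := LinearMap.id
     map_D := fun _ => rfl
     map_bracket := fun u v => by
       change _ = (LinearMap.id : X.carrier →ₗ[F] X.carrier).lTensor F[X] _
       simp
     map_anchor := fun _ => rfl }, Function.bijective_id, fun _ => rfl, fun _ => rfl⟩

theorem AbExt.Equivalent.symm {X Y : AbExt L M} : X.Equivalent Y → Y.Equivalent X := by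
  rintro ⟨χ, hb, h1, h2⟩
  let e := LinearEquiv.ofBijective χ.toLinearMap hb
  have he : ∀ x, χ.toLinearMap (e.symm x) = x := fun x => e.apply_symm_apply x
  have he' : ∀ x, e.symm (χ.toLinearMap x) = x := fun x => e.symm_apply_apply x
  refine ⟨{ toLinearMap := e.symm.toLinearMap
            map_D := fun u => ?_
            map_bracket := fun u v => ?_
            map_anchor := fun u => ?_ }, e.symm.bijective, fun m => ?_, fun x => ?_⟩
  · apply hb.1
    exact (he _).trans (((χ.map_D (e.symm u)).trans (congrArg (D δ) (he u))).symm)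
  · have h := χ.map_bracket (e.symm u) (e.symm v)
    change Y.lcad.bracket (χ.toLinearMap (e.symm u)) (χ.toLinearMap (e.symm v)) = _ at h
    rw [he, he] at h
    rw [h, ← LinearMap.comp_apply, ← LinearMap.lTensor_comp]
    have : (e.symm.toLinearMap.restrictScalars F) ∘ₗ (χ.toLinearMap.restrictScalars F)
        = LinearMap.id := LinearMap.ext he'
    rw [this]
    simp
  · have h := χ.map_anchor (e.symm u)
    change Y.lcad.anchor (χ.toLinearMap (e.symm u)) = _ at h
    rw [he] at h
    exact h.symm
  · exact hb.1 ((he _).trans (h1 m).symm)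
  · have h := h2 (e.symm x)
    rw [he] at h
    exact h.symm

theorem AbExt.Equivalent.trans {X Y Z : AbExt L M} :
    X.Equivalent Y → Y.Equivalent Z → X.Equivalent Z := by
  rintro ⟨χ, hb, h1, h2⟩ ⟨χ', hb', h1', h2'⟩
  refine ⟨{ toLinearMap := χ'.toLinearMap ∘ₗ χ.toLinearMap
            map_D := fun u => ?_
            map_bracket := fun u v => ?_
            map_anchor := fun u => ?_ }, hb'.comp hb, fun m => ?_, fun x => ?_⟩
  · exact (congrArg χ'.toLinearMap (χ.map_D u)).trans (χ'.map_D _)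
  · refine (χ'.map_bracket (χ.toLinearMap u) (χ.toLinearMap v)).trans ?_
    refine (congrArg _ (χ.map_bracket u v)).trans ?_
    rw [← LinearMap.comp_apply, ← LinearMap.lTensor_comp]
    rfl
  · exact (χ'.map_anchor _).trans (χ.map_anchor u)
  · exact (congrArg χ'.toLinearMap (h1 m)).trans (h1' m)
  · exact (h2' _).trans (h2 x)

/-- The `A[∂]`-split abelian extensions of `E` by the `E`-module `M`. -/
def SplitExt (R : LCAdModule L M) : Type (max uF uA (uE + 1) (uM + 1)) :=
  {X : AbExt L M // X.IsSplit ∧ X.InducesAction R}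

/-- Equivalence of `A[∂]`-split abelian extensions of `E` by the `E`-module `M`. -/
instance SplitExt.setoid (R : LCAdModule L M) : Setoid (SplitExt R) where
  r X Y := X.1.Equivalent Y.1
  iseqv := ⟨fun X => .refl X.1, fun h => h.symm, fun h h' => h.trans h'⟩

/-! ### Extensions of the form `E ⊕ M` -/

/-- The `λ`-bracket
`[u + m _λ v + n] = [u_λ v] + ω_λ(u, v) + u_λ n - (|_{x=∂} v_{-λ-x} m)` on `E ⊕ M`. -/
def twistedBracket (R : LCAdModule L M) (ω : E →ₗ[F] E →ₗ[F] F[X] ⊗[F] M) :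
    (E × M) →ₗ[F] (E × M) →ₗ[F] F[X] ⊗[F] (E × M) :=
  LinearMap.mk₂ F
    (fun x y => (LinearMap.inl F E M).lTensor F[X] (L.bracket x.1 y.1)
      + (LinearMap.inr F E M).lTensor F[X]
          (ω x.1 y.1 + R.act x.1 y.2 - adj δ (R.act y.1 x.2)))
    (by intros; simp only [Prod.fst_add, Prod.snd_add, map_add, LinearMap.add_apply, map_sub]
        abel)
    (by intros; simp only [Prod.smul_fst, Prod.smul_snd, map_smul, LinearMap.smul_apply,
          map_sub, map_add, smul_add, smul_sub])
    (by intros; simp only [Prod.fst_add, Prod.snd_add, map_add, LinearMap.add_apply, map_sub]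
        abel)
    (by intros; simp only [Prod.smul_fst, Prod.smul_snd, map_smul, LinearMap.smul_apply,
          map_sub, map_add, smul_add, smul_sub])

/-- The anchor map `u + m ↦ θ(u)` on `E ⊕ M`. -/
def twistedAnchor (L : LCAd δ E) (M : Type uM) [AddCommGroup M] [Module F M] :
    (E × M) →ₗ[F] CDer δ :=
  L.anchor ∘ₗ LinearMap.fst F E M

/-- The map `ω` defines an extension: the left `A[∂]`-module `E ⊕ M`, with the `λ`-bracket and
the anchor map above, is a Lie conformal algebroid. -/
def DefinesExtension (R : LCAdModule L M) (ω : E →ₗ[F] E →ₗ[F] F[X] ⊗[F] M) : Prop :=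
  IsLCAd δ (twistedBracket R ω) (twistedAnchor L M)

/-- The Lie conformal algebroid `E ⊕ M` defined by `ω`. -/
def twistedLCAd (R : LCAdModule L M) (ω : E →ₗ[F] E →ₗ[F] F[X] ⊗[F] M)
    (h : DefinesExtension R ω) : LCAd δ (E × M) where
  bracket := twistedBracket R ω
  anchor := twistedAnchor L M
  isLCAd := h

/-- The `A[∂]`-split abelian extension `0 → M → E ⊕ M → E → 0` defined by `ω`. -/
def extOf (R : LCAdModule L M) (ω : E →ₗ[F] E →ₗ[F] F[X] ⊗[F] M)
    (h : DefinesExtension R ω) : SplitExt R :=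
  ⟨{ carrier := E × M
     lcad := twistedLCAd R ω h
     ι :=
      { toLinearMap := LinearMap.inr A E M
        map_D := fun m => by
          change ((0 : E), D δ m) = (D δ (0 : E), D δ m)
          simp
        map_bracket := fun m n => by
          change twistedBracket R ω ((0 : E), m) ((0 : E), n) = _
          simp [twistedBracket, abelianLCAd]
        map_anchor := fun m => by
          change L.anchor (0 : E) = _
          simp [abelianLCAd] }
     p :=
      { toLinearMap := LinearMap.fst A E M
        map_D := fun _ => rfl
        map_bracket := fun x y => by
          change L.bracket x.1 y.1
            = (LinearMap.fst F E M).lTensor F[X] (twistedBracket R ω x y)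
          have h1 : ∀ z : F[X] ⊗[F] E, (LinearMap.fst F E M).lTensor F[X]
              ((LinearMap.inl F E M).lTensor F[X] z) = z := fun z => by
            rw [← LinearMap.comp_apply, ← LinearMap.lTensor_comp, LinearMap.fst_comp_inl]
            simp
          have h2 : ∀ z : F[X] ⊗[F] M, (LinearMap.fst F E M).lTensor F[X]
              ((LinearMap.inr F E M).lTensor F[X] z) = 0 := fun z => by
            rw [← LinearMap.comp_apply, ← LinearMap.lTensor_comp, LinearMap.fst_comp_inr]
            simp
          simp only [twistedBracket, LinearMap.mk₂_apply, map_add, h1, h2, add_zero]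
        map_anchor := fun _ => rfl }
     ι_injective := LinearMap.inr_injective
     p_surjective := LinearMap.fst_surjective
     exact := fun x => by
      constructor
      · intro hx
        exact ⟨x.2, Prod.ext hx.symm rfl⟩
      · rintro ⟨m, rfl⟩
        rfl },
    ⟨LinearMap.inl A E M, fun u => by
      change (D δ u, (0 : M)) = (D δ u, D δ (0 : M))
      simp, fun _ => rfl⟩,
    fun x m => by
      change twistedBracket R ω x ((0 : E), m)
        = (LinearMap.inr F E M).lTensor F[X] (R.act x.1 m)
      simp [twistedBracket]⟩

/-- An extension of `E` by the `E`-module `M` is trivial if it is equivalent to the one with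
`ω = 0`, i.e. to the semidirect sum of `E` and `M`. -/
def SplitExt.IsTrivial {R : LCAdModule L M} (X : SplitExt R) : Prop :=
  ∃ h : DefinesExtension R 0, X.1.Equivalent (extOf R 0 h).1

/-- The map `φ_{λ₁, λ₂}(u₁, u₂) = ω_{λ₁}(u₁, u₂)` with values in
`M[λ₁, λ₂] / ⟨∂ + λ₁ + λ₂⟩`. -/
def toCochain : (E →ₗ[F] E →ₗ[F] F[X] ⊗[F] M) →ₗ[F]
    MultilinearMap F (fun _ : Fin 2 => E) (Values δ M 2) where
  toFun ω :=
    { toFun := fun u => toValues δ M 2 (subst (MvPolynomial.X 0) (ω (u 0) (u 1)))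
      map_update_add' := by
        intro _ u i x y
        fin_cases i <;> simp
      map_update_smul' := by
        intro _ u i c x
        fin_cases i <;> simp }
  map_add' ω η := by ext; simp
  map_smul' c ω := by ext; simp

end Extensions

end

end ConformalAlgebroid

/-! In `M[λ₁, …, λ_k] / ⟨∂ + λ₁ + ⋯ + λ_k⟩` one variable can be eliminated by setting it equal to
`-∂` minus the others. So the value space is `M` for `k = 1` (`constValue`), it is `M[λ]` for `k =
2` (`firstValue`), and `M[λ, μ]` embeds in it for `k = 3` (`toValues_three_injective`). A 2-cochain
is therefore a form `ω` with values in `M[λ]` satisfying the sesquilinearity, skewsymmetry and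
`A`-linearity conditions, and a 1-cochain is an `A[∂]`-linear map `g : E → M`. Under `firstValue`
the exchange of `λ₁` and `λ₂` becomes `adj`, which gives the rules of calculation for `adj`.

The axioms for `E ⊕ M` split into two components. The `E`-component is the axiom for `E`. In the
`M`-component the terms containing elements of `M` match by the module axioms, and what remains is a
condition on `ω`. For the Jacobi identity this condition is compared in the value space with `k =
3`, where substitutions of `-λ-μ-∂` turn into the variable `λ₃`; the class obtained is `dφ^ω`
(`toValues_twisted_jacobi`, `d_two_toCochain`). Hence `ω` defines an extension exactly when `φ^ω` is
a cocycle (`toCochain_mem_cocycles_iff`).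

An equivalence between two extensions on `E ⊕ M` is a shear `u + m ↦ u + m + g(u)`, and it respects
the brackets exactly when the two forms differ by `dg` (`shear_bracket_iff`,
`extOf_equivalent_iff`). The same shear shows that coboundaries are cocycles, by pulling back the
semidirect sum. Finally, a splitting `s` identifies any split extension with some `E ⊕ M` through `u
+ m ↦ s(u) + ι(m)` (`exists_extOf_equivalent`). -/

namespace ConformalAlgebroid

open DiffModule

noncomputable section

section Calculus

variable {F : Type*} [Field F] {A : Type*} [CommRing A] [Algebra F A] {δ : Derivation F A A}
  {P : Type*} [CommRing P] [Algebra F P] {Q : Type*} [CommRing Q] [Algebra F Q]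
  {M : Type*} [AddCommGroup M] [Module F M]
  {N : Type*} [AddCommGroup N] [Module F N]
  {K : Type*} [AddCommGroup K] [Module F K]

/-! ### Naturality -/

@[simp] theorem subst_tmul (ℓ : P) (p : F[X]) (m : M) :
    subst ℓ (p ⊗ₜ[F] m) = (Polynomial.aeval ℓ p) ⊗ₜ[F] m := rfl

@[simp] theorem applyAt_tmul (ℓ p : P) (g : M →ₗ[F] F[X] ⊗[F] N) (m : M) :
    applyAt ℓ g (p ⊗ₜ[F] m) = p • subst ℓ (g m) := by
  simp [applyAt]

theorem subst_smul (ℓ : P) (p : F[X]) (f : F[X] ⊗[F] M) :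
    subst ℓ (p • f) = Polynomial.aeval ℓ p • subst ℓ f := by
  induction f with
  | zero => simp
  | add x y hx hy => simp [hx, hy]
  | tmul q m => simp [TensorProduct.smul_tmul']

theorem lTensor_smul (φ : M →ₗ[F] N) (p : P) (f : P ⊗[F] M) :
    φ.lTensor P (p • f) = p • φ.lTensor P f := by
  induction f with
  | zero => simp
  | add x y hx hy => simp only [smul_add, map_add, hx, hy]
  | tmul q m => simp [TensorProduct.smul_tmul']

theorem rTensor_smul (σ : P →ₐ[F] Q) (p : P) (f : P ⊗[F] M) :
    σ.toLinearMap.rTensor M (p • f) = σ p • σ.toLinearMap.rTensor M f := by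
  induction f with
  | zero => simp
  | add x y hx hy => simp only [smul_add, map_add, hx, hy]
  | tmul q m => simp [TensorProduct.smul_tmul']

theorem lTensor_subst (φ : M →ₗ[F] N) (ℓ : P) (f : F[X] ⊗[F] M) :
    φ.lTensor P (subst ℓ f) = subst ℓ (φ.lTensor F[X] f) := by
  induction f with
  | zero => simp
  | add x y hx hy => simp only [map_add, hx, hy]
  | tmul p m => simp

theorem rTensor_subst (σ : P →ₐ[F] Q) (ℓ : P) (f : F[X] ⊗[F] M) :
    σ.toLinearMap.rTensor M (subst ℓ f) = subst (σ ℓ) f := by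
  induction f with
  | zero => simp
  | add x y hx hy => simp only [map_add, hx, hy]
  | tmul p m => simp [Polynomial.aeval_algHom_apply]

theorem lTensor_applyAt (φ : N →ₗ[F] K) (ℓ : P) (g : M →ₗ[F] F[X] ⊗[F] N) (x : P ⊗[F] M) :
    φ.lTensor P (applyAt ℓ g x) = applyAt ℓ (φ.lTensor F[X] ∘ₗ g) x := by
  induction x with
  | zero => simp
  | add x y hx hy => simp only [map_add, hx, hy]
  | tmul p m => simp [lTensor_smul, lTensor_subst]

theorem applyAt_comp (φ : K →ₗ[F] M) (ℓ : P) (g : M →ₗ[F] F[X] ⊗[F] N) (x : P ⊗[F] K) :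
    applyAt ℓ (g ∘ₗ φ) x = applyAt ℓ g (φ.lTensor P x) := by
  induction x with
  | zero => simp
  | add x y hx hy => simp only [map_add, hx, hy]
  | tmul p m => simp

theorem applyAt_add (ℓ : P) (g h : M →ₗ[F] F[X] ⊗[F] N) (x : P ⊗[F] M) :
    applyAt ℓ (g + h) x = applyAt ℓ g x + applyAt ℓ h x := by
  induction x with
  | zero => simp
  | add x y hx hy => simp only [map_add, hx, hy]; abel
  | tmul p m => simp

theorem applyAt_neg (ℓ : P) (g : M →ₗ[F] F[X] ⊗[F] N) (x : P ⊗[F] M) :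
    applyAt ℓ (-g) x = -applyAt ℓ g x := by
  induction x with
  | zero => simp
  | add x y hx hy => simp only [map_add, hx, hy]; abel
  | tmul p m => simp

theorem applyAt_sub (ℓ : P) (g h : M →ₗ[F] F[X] ⊗[F] N) (x : P ⊗[F] M) :
    applyAt ℓ (g - h) x = applyAt ℓ g x - applyAt ℓ h x := by
  rw [sub_eq_add_neg g h, applyAt_add, applyAt_neg, ← sub_eq_add_neg]

theorem rTensor_applyAt (σ : P →ₐ[F] Q) (ℓ : P) (g : M →ₗ[F] F[X] ⊗[F] N) (x : P ⊗[F] M) :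
    σ.toLinearMap.rTensor N (applyAt ℓ g x)
      = applyAt (σ ℓ) g (σ.toLinearMap.rTensor M x) := by
  induction x with
  | zero => simp
  | add x y hx hy => simp only [map_add, hx, hy]
  | tmul p m => simp [rTensor_smul, rTensor_subst]

section Scalars

variable [Module A M] [IsScalarTower F A M] [Module A N] [IsScalarTower F A N]

theorem lTensor_coeffSMul (φ : M →ₗ[A] N) (a : A) (x : P ⊗[F] M) :
    (φ.restrictScalars F).lTensor P (coeffSMul a x)
      = coeffSMul a ((φ.restrictScalars F).lTensor P x) := by
  induction x with
  | zero => simp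
  | add x y hx hy => simp only [map_add, hx, hy]
  | tmul p m => simp [coeffSMul]

theorem lTensor_coeffMul (φ : M →ₗ[A] N) (m : M) (x : P ⊗[F] A) :
    (φ.restrictScalars F).lTensor P (coeffMul m x) = coeffMul (φ m) x := by
  induction x with
  | zero => simp
  | add x y hx hy => simp only [map_add, hx, hy]
  | tmul p m => simp [coeffMul]

theorem coeffMul_zero (x : P ⊗[F] A) : coeffMul (0 : M) x = 0 := by
  induction x with
  | zero => simp
  | add x y hx hy => simp only [map_add, hx, hy, add_zero]
  | tmul p a => simp [coeffMul]

end Scalars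

/-! ### Operators involving `∂` -/

section Derivative

variable [Module A M] [IsScalarTower F A M] [DiffModule δ M]
  [Module A N] [IsScalarTower F A N] [DiffModule δ N]

theorem lTensor_dPlus (φ : M →ₗ[F] N) (hφ : ∀ m, φ (D δ m) = D δ (φ m)) (ℓ : P)
    (x : P ⊗[F] M) : φ.lTensor P (dPlus δ ℓ x) = dPlus δ ℓ (φ.lTensor P x) := by
  induction x with
  | zero => simp
  | add x y hx hy => simp only [map_add, hx, hy]
  | tmul p m => simp [dPlus_tmul, hφ]

theorem adj_tmul (p : F[X]) (m : M) :
    adj δ (p ⊗ₜ[F] m) = Polynomial.aeval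
      (-((dPlus δ (Polynomial.X : F[X]) (M := M)).restrictScalars F)) p (1 ⊗ₜ[F] m) := by
  simp [adj]

theorem lTensor_adj (φ : M →ₗ[F] N) (hφ : ∀ m, φ (D δ m) = D δ (φ m)) (f : F[X] ⊗[F] M) :
    φ.lTensor F[X] (adj δ f) = adj δ (φ.lTensor F[X] f) := by
  have key : ∀ (p : F[X]) (y : F[X] ⊗[F] M), φ.lTensor F[X] (Polynomial.aeval
      (-((dPlus δ (Polynomial.X : F[X]) (M := M)).restrictScalars F)) p y)
      = Polynomial.aeval
      (-((dPlus δ (Polynomial.X : F[X]) (M := N)).restrictScalars F)) p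
        (φ.lTensor F[X] y) := by
    intro p
    induction p using Polynomial.induction_on with
    | C a => intro y; simp
    | add p q hp hq => intro y; simp [hp, hq]
    | monomial n a h =>
      intro y
      rw [pow_succ, ← mul_assoc, map_mul _ (_ * _) Polynomial.X, map_mul _ (_ * _) Polynomial.X,
        Module.End.mul_apply, Module.End.mul_apply, h]
      simp [lTensor_dPlus φ hφ]
  induction f with
  | zero => simp
  | add x y hx hy => simp only [map_add, hx, hy]
  | tmul p m => simp [adj_tmul, key]

theorem dPlus_add (ℓ t : P) (x : P ⊗[F] M) : dPlus δ (ℓ + t) x = dPlus δ ℓ x + t • x := by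
  simp [dPlus, add_smul, add_assoc]

/-- On coefficients `g_ℓ(∂m) = (∂ + ℓ) g_ℓ(m)`, so passing through `g_ℓ` adds `ℓ` to the parameter.
-/
theorem applyAt_dPlus (ℓ t : P) (g : M →ₗ[F] F[X] ⊗[F] N)
    (hg : ∀ m, g (D δ m) = dPlus δ Polynomial.X (g m)) (x : P ⊗[F] M) :
    applyAt ℓ g (dPlus δ t x) = dPlus δ (ℓ + t) (applyAt ℓ g x) := by
  induction x with
  | zero => simp
  | add x y hx hy => simp only [map_add, hx, hy]
  | tmul p m =>
    rw [dPlus_tmul, map_add, applyAt_tmul, hg, subst_dPlus, dPlus_add, applyAt_tmul, applyAt_tmul,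
      map_smul, mul_smul]

/-! ### Congruences modulo `∂ + s` -/

/-- `adj` substitutes `-(∂ + λ)` for `λ`, and `-(∂ + ℓ) = ℓ' - (∂ + s)`. Modulo `∂ + s` it therefore
exchanges `ℓ` for its complement `ℓ'`. -/
theorem subst_adj_sub_mem {s ℓ ℓ' : P} (h : ℓ + ℓ' = s) (f : F[X] ⊗[F] M) :
    subst ℓ (adj δ f) - subst ℓ' f ∈ LinearMap.range (dPlus δ s (M := M)) := by
  have key : ∀ (p : F[X]) (y : F[X] ⊗[F] M), subst ℓ (Polynomial.aeval
      (-((dPlus δ (Polynomial.X : F[X]) (M := M)).restrictScalars F)) p y)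
        - Polynomial.aeval ℓ' p • subst ℓ y ∈ LinearMap.range (dPlus δ s (M := M)) := by
    intro p
    induction p using Polynomial.induction_on with
    | C a => intro y; simp
    | add p q hp hq =>
      intro y
      have := add_mem (hp y) (hq y)
      simp only [map_add, LinearMap.add_apply, add_smul]
      convert this using 1
      abel
    | monomial n a hn =>
      intro y
      -- One factor `-(∂ + λ)` is absorbed into `y`, which is why the induction is for all `y`; `h2`
      -- is the error made in replacing it by `ℓ'`.
      have h1 := hn (-(dPlus δ (Polynomial.X : F[X]) (M := M)) y)
      have h2 : Polynomial.aeval ℓ' (Polynomial.C a * Polynomial.X ^ n) •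
          dPlus δ s (subst ℓ y) ∈ LinearMap.range (dPlus δ s (M := M)) :=
        Submodule.smul_mem _ _ ⟨_, rfl⟩
      have h3 := sub_mem h1 h2
      rw [← h, dPlus_add] at h3
      rw [pow_succ, ← mul_assoc, map_mul _ (_ * _) Polynomial.X, map_mul _ (_ * _) Polynomial.X,
        Module.End.mul_apply, mul_smul]
      rw [h] at h3
      convert h3 using 1
      simp only [map_neg, subst_dPlus, smul_neg, smul_add, Polynomial.aeval_X,
        LinearMap.neg_apply, LinearMap.coe_restrictScalars]
      abel
  induction f with
  | zero => simp
  | add x y hx hy =>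
    have := add_mem hx hy
    simp only [map_add]
    convert this using 1
    abel
  | tmul p m =>
    have := key p (1 ⊗ₜ m)
    rw [← adj_tmul] at this
    simpa [TensorProduct.smul_tmul'] using this

theorem applyAt_adj_sub_mem {s ℓ ℓ' : P} (h : ℓ + ℓ' = s) (g : K →ₗ[F] F[X] ⊗[F] M)
    (x : P ⊗[F] K) :
    applyAt ℓ (adj δ ∘ₗ g) x - applyAt ℓ' g x ∈ LinearMap.range (dPlus δ s (M := M)) := by
  induction x with
  | zero => simp
  | add x y hx hy =>
    have := add_mem hx hy
    simp only [map_add]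
    convert this using 1
    abel
  | tmul p n =>
    have := Submodule.smul_mem _ p (subst_adj_sub_mem (δ := δ) h (g n))
    simpa [smul_sub] using this

/-- By `applyAt_dPlus`, `g_ℓ` carries a congruence modulo `∂ + t + t'` to one modulo `∂ + s`. -/
theorem applyAt_subst_adj_sub_mem {s ℓ t t' : P} (h : ℓ + t + t' = s)
    (g : M →ₗ[F] F[X] ⊗[F] N) (hg : ∀ m, g (D δ m) = dPlus δ Polynomial.X (g m))
    (f : F[X] ⊗[F] M) :
    applyAt ℓ g (subst t (adj δ f)) - applyAt ℓ g (subst t' f) ∈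
      LinearMap.range (dPlus δ s (M := N)) := by
  obtain ⟨y, hy⟩ := subst_adj_sub_mem (δ := δ) (rfl : t + t' = _) f
  refine ⟨applyAt ℓ g y, ?_⟩
  rw [← map_sub, ← hy, applyAt_dPlus ℓ _ g hg, ← h, add_assoc]

/-- Elements without the variable `s - s'` that are multiples of `∂ + s` vanish. -/
theorem eq_zero_of_rTensor_mem (j : P →ₐ[F] Q) (τ : Q →ₐ[F] P[X]) (s : Q) (s' : P)
    (hj : ∀ p, τ (j p) = Polynomial.C p) (hs : τ s = Polynomial.C s' + Polynomial.X)
    (x : P ⊗[F] M)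
    (hx : j.toLinearMap.rTensor M x ∈ LinearMap.range (dPlus δ s (M := M))) : x = 0 := by
  -- `T` substitutes `-(∂ + s')` for the extra variable. The resulting `ρ` is a left inverse of the
  -- inclusion and kills multiples of `∂ + s`.
  let T : P[X] →ₐ[P] Module.End P (P ⊗[F] M) := Polynomial.aeval (-dPlus δ s' (M := M))
  let ρ : Q ⊗[F] M →ₗ[F] P ⊗[F] M := TensorProduct.lift (LinearMap.mk₂ F
    (fun q m => T (τ q) (1 ⊗ₜ[F] m)) (by intros; simp)
    (by
      intro c q m
      rw [map_smul, ← algebraMap_smul P c, map_smul, LinearMap.smul_apply, algebraMap_smul])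
    (by intros; simp [TensorProduct.tmul_add]) (by intros; simp))
  have hρ : ∀ q m, ρ (q ⊗ₜ m) = T (τ q) (1 ⊗ₜ[F] m) := fun q m => by simp [ρ]
  have h1 : ρ (j.toLinearMap.rTensor M x) = x := by
    clear hx
    induction x with
    | zero => simp
    | add x y hx hy => simp only [map_add, hx, hy]
    | tmul p m => simp [hρ, hj, T, Algebra.algebraMap_eq_smul_one, TensorProduct.smul_tmul']
  obtain ⟨y, hy⟩ := hx
  rw [← h1, ← hy]
  clear hy
  induction y with
  | zero => simp
  | add x y hx hy => simp only [map_add, hx, hy, add_zero]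
  | tmul q m =>
    have h2 : T (τ s) (1 ⊗ₜ[F] m) = -(1 ⊗ₜ[F] D δ m) := by
      rw [hs]
      simp [T, dPlus_tmul, Algebra.algebraMap_eq_smul_one, TensorProduct.smul_tmul']
    -- `mul_comm` lets `s` act first, where it equals `-∂` on `1 ⊗ m`; the two summands then cancel.
    rw [dPlus_tmul, map_add, hρ, hρ, mul_comm, map_mul, map_mul, Module.End.mul_apply, h2]
    simp

end Derivative

end Calculus

section ValueSpaces

variable {F : Type*} [Field F] {A : Type*} [CommRing A] [Algebra F A] {δ : Derivation F A A}
  {M : Type*} [AddCommGroup M] [Module F M] [Module A M] [IsScalarTower F A M] [DiffModule δ M]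
  {N : Type*} [AddCommGroup N] [Module F N] [Module A N] [IsScalarTower F A N] [DiffModule δ N]
  {K : Type*} [AddCommGroup K] [Module F K]

/-! ### The spaces of values of cochains -/

theorem toValues_eq_zero_iff {k : ℕ} (x : MvPolynomial (Fin k) F ⊗[F] M) :
    toValues δ M k x = 0 ↔ x ∈ LinearMap.range (dPlus δ (lamSum F k) (M := M)) :=
  Submodule.Quotient.mk_eq_zero _

theorem toValues_eq_iff {k : ℕ} (x y : MvPolynomial (Fin k) F ⊗[F] M) :
    toValues δ M k x = toValues δ M k y ↔
      x - y ∈ LinearMap.range (dPlus δ (lamSum F k) (M := M)) := by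
  rw [← sub_eq_zero, ← map_sub, toValues_eq_zero_iff]

theorem mulValues_toValues {k : ℕ} (p : MvPolynomial (Fin k) F)
    (x : MvPolynomial (Fin k) F ⊗[F] M) :
    mulValues δ k p (toValues δ M k x) = toValues δ M k (p • x) := rfl

theorem shiftValues_toValues {k : ℕ} (i : Fin k) (a : A)
    (x : MvPolynomial (Fin k) F ⊗[F] M) :
    shiftValues δ i a (toValues δ M k x) = toValues δ M k (shiftPoly δ i a x) := rfl

theorem substValues_toValues {k l : ℕ}
    (s : MvPolynomial (Fin k) F →ₐ[F] MvPolynomial (Fin l) F)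
    (hs : s (lamSum F k) = lamSum F l) (x : MvPolynomial (Fin k) F ⊗[F] M) :
    substValues δ s hs (toValues δ M k x) = toValues δ M l (s.toLinearMap.rTensor M x) := rfl

theorem toValues_subst_adj {k : ℕ} {ℓ ℓ' : MvPolynomial (Fin k) F} (h : ℓ + ℓ' = lamSum F k)
    (f : F[X] ⊗[F] M) :
    toValues δ M k (subst ℓ (adj δ f)) = toValues δ M k (subst ℓ' f) :=
  (toValues_eq_iff _ _).2 (subst_adj_sub_mem h f)

theorem toValues_applyAt_adj {k : ℕ} {ℓ ℓ' : MvPolynomial (Fin k) F}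
    (h : ℓ + ℓ' = lamSum F k) (g : K →ₗ[F] F[X] ⊗[F] M) (x : MvPolynomial (Fin k) F ⊗[F] K) :
    toValues δ M k (applyAt ℓ (adj δ ∘ₗ g) x) = toValues δ M k (applyAt ℓ' g x) :=
  (toValues_eq_iff _ _).2 (applyAt_adj_sub_mem h g x)

theorem toValues_applyAt_subst_adj {k : ℕ} {ℓ t t' : MvPolynomial (Fin k) F}
    (h : ℓ + t + t' = lamSum F k) (g : N →ₗ[F] F[X] ⊗[F] M)
    (hg : ∀ m, g (D δ m) = dPlus δ Polynomial.X (g m)) (f : F[X] ⊗[F] N) :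
    toValues δ M k (applyAt ℓ g (subst t (adj δ f)))
      = toValues δ M k (applyAt ℓ g (subst t' f)) :=
  (toValues_eq_iff _ _).2 (applyAt_subst_adj_sub_mem h g hg f)

theorem lamSum_one : lamSum F 1 = MvPolynomial.X 0 := by simp [lamSum]

theorem lamSum_two : lamSum F 2 = MvPolynomial.X 0 + MvPolynomial.X 1 := by
  simp [lamSum, Fin.sum_univ_two]

theorem lamSum_three :
    lamSum F 3 = MvPolynomial.X 0 + MvPolynomial.X 1 + MvPolynomial.X 2 := by
  simp [lamSum, Fin.sum_univ_three]

variable (δ M) in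
/-- The map `M → M[λ] / ⟨∂ + λ⟩`. -/
def constValue : M →ₗ[F] Values δ M 1 :=
  toValues δ M 1 ∘ₗ TensorProduct.mk F (MvPolynomial (Fin 1) F) M 1

variable (δ M) in
/-- The map `M[λ] → M[λ₁, λ₂] / ⟨∂ + λ₁ + λ₂⟩`, `f_λ ↦ f_{λ₁}`. -/
def firstValue : F[X] ⊗[F] M →ₗ[F] Values δ M 2 :=
  toValues δ M 2 ∘ₗ subst (MvPolynomial.X 0)

theorem constValue_apply (m : M) : constValue δ M m = toValues δ M 1 (1 ⊗ₜ[F] m) := rfl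

theorem firstValue_apply (f : F[X] ⊗[F] M) :
    firstValue δ M f = toValues δ M 2 (subst (MvPolynomial.X 0) f) := rfl

/-- Elimination of `λ₃`. It allows identities in `M[λ, μ]` to be checked in the value space of
3-cochains. -/
theorem toValues_three_injective {x : MvPolynomial (Fin 2) F ⊗[F] M}
    (hx : toValues δ M 3 ((MvPolynomial.rename (R := F) Fin.castSucc).toLinearMap.rTensor M x)
      = 0) : x = 0 := by
  rw [toValues_eq_zero_iff] at hx
  refine eq_zero_of_rTensor_mem _ (MvPolynomial.aeval
    ![Polynomial.C (MvPolynomial.X 0), Polynomial.C (MvPolynomial.X 1), Polynomial.X])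
    _ (MvPolynomial.X 0 + MvPolynomial.X 1) (fun p => ?_) ?_ x hx
  · induction p using MvPolynomial.induction_on with
    | C a => simp [MvPolynomial.algebraMap_eq, Polynomial.algebraMap_apply]
    | add p q hp hq => simp only [map_add, hp, hq]
    | mul_X p i hp =>
      simp only [map_mul, hp]
      fin_cases i <;> simp
  · simp [lamSum_three]

theorem firstValue_injective : Function.Injective (firstValue δ M) := by
  rw [← LinearMap.ker_eq_bot, LinearMap.ker_eq_bot']
  intro x hx
  rw [firstValue_apply, toValues_eq_zero_iff] at hx
  refine eq_zero_of_rTensor_mem _ (MvPolynomial.aeval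
    ![Polynomial.C Polynomial.X, Polynomial.X]) _ Polynomial.X (fun p => ?_) ?_ x hx
  · induction p using Polynomial.induction_on with
    | C a => simp [Polynomial.algebraMap_apply]
    | add p q hp hq => simp only [map_add, hp, hq]
    | monomial n a h => simp [Polynomial.algebraMap_apply]
  · simp [lamSum_two]

theorem constValue_injective : Function.Injective (constValue δ M) := by
  rw [← LinearMap.ker_eq_bot, LinearMap.ker_eq_bot']
  intro m hm
  rw [constValue_apply, toValues_eq_zero_iff] at hm
  have := eq_zero_of_rTensor_mem (Algebra.ofId F (MvPolynomial (Fin 1) F)) (MvPolynomial.aeval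
    ![(Polynomial.X : F[X])]) _ 0 (fun p => ?_) ?_ ((1 : F) ⊗ₜ[F] m) (by simpa using hm)
  · simpa using congrArg (TensorProduct.lid F M) this
  · simp [Algebra.ofId_apply]
  · simp [lamSum_one]

/-- The defining relation solved for `t`: in the quotient, `t` acts as `-(∂ + s)`. -/
theorem toValues_eq_neg_dPlus {k : ℕ} {s t : MvPolynomial (Fin k) F} (h : s + t = lamSum F k)
    (x : MvPolynomial (Fin k) F ⊗[F] M) :
    toValues δ M k (t • x) = toValues δ M k (-(dPlus δ s x)) := by
  rw [toValues_eq_iff]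
  exact ⟨x, by rw [← h, dPlus_add]; abel⟩

theorem mulValues_firstValue_zero (f : F[X] ⊗[F] M) :
    mulValues δ 2 (MvPolynomial.X 0) (firstValue δ M f)
      = firstValue δ M ((Polynomial.X : F[X]) • f) := by
  rw [firstValue_apply, mulValues_toValues, firstValue_apply, subst_smul, Polynomial.aeval_X]

theorem mulValues_firstValue_one (f : F[X] ⊗[F] M) :
    mulValues δ 2 (MvPolynomial.X 1) (firstValue δ M f)
      = firstValue δ M (-(dPlus δ (Polynomial.X : F[X]) f)) := by
  rw [firstValue_apply, mulValues_toValues, firstValue_apply,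
    toValues_eq_neg_dPlus lamSum_two.symm, map_neg, map_neg, map_neg, subst_dPlus]

/-- The image contains the constants and is stable under multiplication by `λ₁` and by `λ₂`. -/
theorem firstValue_surjective : Function.Surjective (firstValue δ M) := by
  intro v
  obtain ⟨x, rfl⟩ := toValues_surjective δ M 2 v
  induction x with
  | zero => exact ⟨0, by simp⟩
  | add x y hx hy =>
    obtain ⟨f, hf⟩ := hx
    obtain ⟨g, hg⟩ := hy
    exact ⟨f + g, by rw [map_add, map_add, hf, hg]⟩
  | tmul p m =>
    induction p using MvPolynomial.induction_on with
    | C a =>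
      refine ⟨Polynomial.C a ⊗ₜ m, ?_⟩
      simp [firstValue_apply, MvPolynomial.algebraMap_eq]
    | add p q hp hq =>
      obtain ⟨f, hf⟩ := hp
      obtain ⟨g, hg⟩ := hq
      exact ⟨f + g, by rw [map_add, TensorProduct.add_tmul, map_add, hf, hg]⟩
    | mul_X p i hp =>
      obtain ⟨f, hf⟩ := hp
      rw [mul_comm, ← smul_eq_mul, ← TensorProduct.smul_tmul', ← mulValues_toValues, ← hf]
      fin_cases i
      · exact ⟨_, (mulValues_firstValue_zero f).symm⟩
      · exact ⟨_, (mulValues_firstValue_one f).symm⟩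

theorem mulValues_constValue (m : M) :
    mulValues δ 1 (MvPolynomial.X 0) (constValue δ M m) = -constValue δ M (D δ m) := by
  rw [constValue_apply, mulValues_toValues, constValue_apply,
    toValues_eq_neg_dPlus (s := 0) (by simp [lamSum_one]), map_neg, dPlus_tmul]
  simp

theorem constValue_surjective : Function.Surjective (constValue δ M) := by
  intro v
  obtain ⟨x, rfl⟩ := toValues_surjective δ M 1 v
  induction x with
  | zero => exact ⟨0, by simp⟩
  | add x y hx hy =>
    obtain ⟨f, hf⟩ := hx
    obtain ⟨g, hg⟩ := hy
    exact ⟨f + g, by rw [map_add, map_add, hf, hg]⟩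
  | tmul p m =>
    induction p using MvPolynomial.induction_on with
    | C a =>
      refine ⟨a • m, ?_⟩
      rw [constValue_apply, ← TensorProduct.smul_tmul, MvPolynomial.smul_eq_C_mul, mul_one]
    | add p q hp hq =>
      obtain ⟨f, hf⟩ := hp
      obtain ⟨g, hg⟩ := hq
      exact ⟨f + g, by rw [map_add, TensorProduct.add_tmul, map_add, hf, hg]⟩
    | mul_X p i hp =>
      obtain ⟨f, hf⟩ := hp
      rw [mul_comm, ← smul_eq_mul, ← TensorProduct.smul_tmul', ← mulValues_toValues, ← hf]
      fin_cases i
      exact ⟨-(D δ f), by rw [map_neg]; exact (mulValues_constValue f).symm⟩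

/-- In terms of `firstValue`, `adj` is the exchange of `λ₁` and `λ₂`. The identities for `adj` below
are read off from this and the injectivity of `firstValue`. -/
theorem toValues_subst_one (f : F[X] ⊗[F] M) :
    toValues δ M 2 (subst (MvPolynomial.X 1) f) = firstValue δ M (adj δ f) :=
  (toValues_subst_adj lamSum_two.symm f).symm

theorem adj_adj (f : F[X] ⊗[F] M) : adj δ (adj δ f) = f := by
  apply firstValue_injective (δ := δ)
  rw [← toValues_subst_one,
    toValues_subst_adj (by rw [lamSum_two, add_comm]) f, firstValue_apply]

/-- The exchange of variables turns multiplication by `λ₂`, which is `-(∂ + λ)` on `M[λ]`, into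
multiplication by `λ₁`. -/
theorem adj_dPlus (f : F[X] ⊗[F] M) :
    adj δ (dPlus δ (Polynomial.X : F[X]) f) = -((Polynomial.X : F[X]) • adj δ f) := by
  apply firstValue_injective (δ := δ)
  rw [map_neg, ← mulValues_firstValue_zero, ← toValues_subst_one, ← toValues_subst_one,
    mulValues_toValues, subst_dPlus,
    toValues_eq_neg_dPlus (s := MvPolynomial.X 1) (by rw [lamSum_two, add_comm]), map_neg,
    neg_neg]

theorem adj_X_smul (f : F[X] ⊗[F] M) :
    adj δ ((Polynomial.X : F[X]) • f) = -(dPlus δ (Polynomial.X : F[X]) (adj δ f)) := by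
  rw [← adj_adj (δ := δ) f, ← neg_eq_iff_eq_neg.2 (adj_dPlus (adj δ f)), map_neg, adj_adj,
    adj_adj]

theorem shiftPoly_subst_self {k : ℕ} (i : Fin k) (a : A) (f : F[X] ⊗[F] M) :
    shiftPoly δ i a (subst (MvPolynomial.X i) f)
      = subst (MvPolynomial.X i) (shift₁ δ a f) := by
  induction f with
  | zero => simp
  | add x y hx hy => simp only [map_add, hx, hy]
  | tmul p m =>
    simp only [subst_tmul, shiftPoly, shift₁, shiftSMul, TensorProduct.lift.tmul,
      LinearMap.comp_apply, AlgHom.toLinearMap_apply]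
    rw [← Polynomial.aeval_algHom_apply, MvPolynomial.aeval_X, if_pos rfl]
    -- The shift is computed in `F[λ][x]` and only then is `λ` specialised to `λ_i`.
    have h : Polynomial.aeval (Polynomial.C (MvPolynomial.X i) + Polynomial.X) p
        = Polynomial.mapAlgHom
          (Polynomial.aeval (MvPolynomial.X i : MvPolynomial (Fin k) F) : F[X] →ₐ[F] _)
          (Polynomial.aeval (Polynomial.C Polynomial.X + Polynomial.X) p) := by
      rw [← Polynomial.aeval_algHom_apply]
      simp
    rw [h]
    generalize (Polynomial.aeval (Polynomial.C Polynomial.X + Polynomial.X) p : F[X][X]) = q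
    induction q using Polynomial.induction_on' with
    | add q r hq hr => simp only [map_add, LinearMap.add_apply, hq, hr]
    | monomial n c => simp [Polynomial.lsum_apply]

theorem shiftPoly_subst_of_ne {k : ℕ} {i j : Fin k} (h : j ≠ i) (a : A) (f : F[X] ⊗[F] M) :
    shiftPoly δ i a (subst (MvPolynomial.X j) f)
      = subst (MvPolynomial.X j) (coeffSMul a f) := by
  induction f with
  | zero => simp
  | add x y hx hy => simp only [map_add, hx, hy]
  | tmul p m =>
    simp only [subst_tmul, shiftPoly, shiftSMul, TensorProduct.lift.tmul,
      LinearMap.comp_apply, AlgHom.toLinearMap_apply]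
    rw [← Polynomial.aeval_algHom_apply, MvPolynomial.aeval_X, if_neg h, add_zero,
      ← Polynomial.algebraMap_eq, Polynomial.aeval_algebraMap_apply, Polynomial.algebraMap_eq]
    simp [Polynomial.lsum_apply, coeffSMul]

/-- For `f_{λ₂}`, which does not involve `λ₁`, the shift in `λ₁` is just multiplication of
coefficients by `a`; the exchange of variables makes it a genuine shift. -/
theorem adj_coeffSMul (a : A) (f : F[X] ⊗[F] M) :
    adj δ (coeffSMul a f) = shift₁ δ a (adj δ f) := by
  apply firstValue_injective (δ := δ)
  rw [← toValues_subst_one, ← shiftPoly_subst_of_ne (δ := δ) (i := (0 : Fin 2)) (by decide),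
    ← shiftValues_toValues, toValues_subst_one, firstValue_apply, shiftValues_toValues,
    shiftPoly_subst_self, firstValue_apply]

theorem adj_shift₁ (a : A) (f : F[X] ⊗[F] M) :
    adj δ (shift₁ δ a f) = coeffSMul a (adj δ f) := by
  rw [← adj_adj (δ := δ) (coeffSMul a (adj δ f)), adj_coeffSMul, adj_adj]

theorem shiftValues_firstValue_zero (a : A) (f : F[X] ⊗[F] M) :
    shiftValues δ 0 a (firstValue δ M f) = firstValue δ M (shift₁ δ a f) := by
  rw [firstValue_apply, shiftValues_toValues, shiftPoly_subst_self, firstValue_apply]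

theorem shiftValues_firstValue_one (a : A) (f : F[X] ⊗[F] M) :
    shiftValues δ 1 a (firstValue δ M f) = firstValue δ M (coeffSMul a f) := by
  rw [firstValue_apply, shiftValues_toValues, shiftPoly_subst_of_ne (by decide),
    firstValue_apply]

theorem shiftValues_constValue (a : A) (m : M) :
    shiftValues δ 0 a (constValue δ M m) = constValue δ M (a • m) := by
  rw [constValue_apply, shiftValues_toValues, constValue_apply]
  rw [shiftPoly, shiftSMul, TensorProduct.lift.tmul, LinearMap.comp_apply,
    AlgHom.toLinearMap_apply, map_one, ← Polynomial.C_1,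
    Polynomial.lsum_apply, Polynomial.sum_C_index (by simp)]
  simp

end ValueSpaces

/-! ### Pulling back a Lie conformal algebroid structure -/

section PullBack

variable {F : Type*} [Field F] {A : Type*} [CommRing A] [Algebra F A] {δ : Derivation F A A}
  {M : Type*} [AddCommGroup M] [Module F M] [Module A M] [IsScalarTower F A M] [DiffModule δ M]
  {N : Type*} [AddCommGroup N] [Module F N] [Module A N] [IsScalarTower F A N] [DiffModule δ N]

theorem lTensor_injective {P : Type*} [CommRing P] [Algebra F P] {φ : M →ₗ[F] N}
    (hφ : Function.Injective φ) : Function.Injective (φ.lTensor P) :=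
  Module.Flat.lTensor_preserves_injective_linearMap φ hφ

/-- The operations in the axioms commute with `χ`, and `χ` stays injective after tensoring because
modules over the field `F` are flat. Each axiom with values in polynomials over the module can then
be tested after applying `χ`; the anchor axioms have values over `A` and transfer directly. -/
theorem IsLCAd.of_injective {B : M →ₗ[F] M →ₗ[F] F[X] ⊗[F] M} {θ : M →ₗ[F] CDer δ}
    {B' : N →ₗ[F] N →ₗ[F] F[X] ⊗[F] N} {θ' : N →ₗ[F] CDer δ} (h : IsLCAd δ B' θ')
    (χ : M →ₗ[A] N) (hχ : Function.Injective χ) (hD : ∀ m, χ (D δ m) = D δ (χ m))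
    (hB : ∀ x y, (χ.restrictScalars F).lTensor F[X] (B x y) = B' (χ x) (χ y))
    (hθ : ∀ x, θ' (χ x) = θ x) : IsLCAd δ B θ := by
  have hinj : ∀ (P : Type _) [CommRing P] [Algebra F P],
      Function.Injective ((χ.restrictScalars F).lTensor P) := fun P _ _ =>
    lTensor_injective hχ
  have hD' : ∀ m, χ.restrictScalars F (D δ m) = D δ (χ.restrictScalars F m) := hD
  have hBl : ∀ x, (χ.restrictScalars F).lTensor F[X] ∘ₗ B x
      = B' (χ x) ∘ₗ χ.restrictScalars F := fun x => LinearMap.ext (hB x)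
  have hBr : ∀ y, (χ.restrictScalars F).lTensor F[X] ∘ₗ B.flip y
      = B'.flip (χ y) ∘ₗ χ.restrictScalars F := fun y => LinearMap.ext fun x => hB x y
  refine ⟨fun a u b => ?_, fun u b => ?_, fun u v => ?_, fun u v => ?_, fun u v => ?_,
    fun u v w => ?_, fun u a v => ?_, fun u v a => ?_⟩
  · rw [← hθ, ← hθ, map_smul, h.anchor_smul]
  · rw [← hθ, ← hθ, hD, h.anchor_D]
  · apply hinj
    rw [hB, hD, h.bracket_D_left, map_neg, lTensor_smul, hB]
  · apply hinj
    rw [hB, hD, h.bracket_D_right, lTensor_dPlus _ hD', hB]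
  · apply hinj
    rw [hB, h.skew, map_neg, lTensor_adj _ hD', hB]
  · apply hinj
    simp only [map_sub, lTensor_applyAt, hBl, hBr, applyAt_comp, lTensor_subst, hB]
    exact h.jacobi _ _ _
  · apply hinj
    rw [hB, map_smul, h.bracket_smul, map_add, lTensor_coeffSMul, lTensor_coeffMul, hB, hθ]
  · have := h.anchor_bracket (χ u) (χ v) a
    rw [hθ, hθ, ← hB, ← lTensor_subst, ← applyAt_comp] at this
    rw [← this]
    congr 3
    ext x
    simp [hθ]

end PullBack

/-! ### The axioms for `E ⊕ M` as conditions on `ω` -/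

section Twisted

variable {F : Type*} [Field F] {A : Type*} [CommRing A] [Algebra F A] {δ : Derivation F A A}
  {E : Type*} [AddCommGroup E] [Module F E] [Module A E] [IsScalarTower F A E] [DiffModule δ E]
  {M : Type*} [AddCommGroup M] [Module F M] [Module A M] [IsScalarTower F A M] [DiffModule δ M]
  {L : LCAd δ E} (R : LCAdModule L M)

/-- The action identity `[u_λ v]_{λ+μ} m = u_λ (v_μ m) - v_μ (u_λ m)` in arbitrary variables. -/
theorem LCAdModule.bracket_act_add {P : Type*} [CommRing P] [Algebra F P] (ℓ ℓ' : P) (u v : E)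
    (m : M) :
    applyAt (ℓ + ℓ') (R.act.flip m) (subst ℓ (L.bracket u v))
      = applyAt ℓ (R.act u) (subst ℓ' (R.act v m))
        - applyAt ℓ' (R.act v) (subst ℓ (R.act u m)) := by
  -- With `λ = ℓ` and `μ = ℓ + ℓ'`, the difference `μ - λ` becomes `ℓ'`.
  have h := congrArg ((MvPolynomial.aeval ![ℓ, ℓ + ℓ']).toLinearMap.rTensor M)
    (R.bracket_act u v m)
  simpa only [map_sub, rTensor_applyAt, rTensor_subst, MvPolynomial.aeval_X, Matrix.cons_val_zero,
    Matrix.cons_val_one, add_sub_cancel_left] using h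

/-- The Jacobi expression of `ω`, i.e. the differential of `ω` as a 2-cochain. -/
def jacobiExpr (ω : E →ₗ[F] E →ₗ[F] F[X] ⊗[F] M) (u v w : E) :
    MvPolynomial (Fin 3) F ⊗[F] M :=
  applyAt (MvPolynomial.X 0) (R.act u) (subst (MvPolynomial.X 1) (ω v w))
    - applyAt (MvPolynomial.X 1) (R.act v) (subst (MvPolynomial.X 0) (ω u w))
    + applyAt (MvPolynomial.X 2) (R.act w) (subst (MvPolynomial.X 0) (ω u v))
    + applyAt (MvPolynomial.X 0) (ω u) (subst (MvPolynomial.X 1) (L.bracket v w))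
    - applyAt (MvPolynomial.X 1) (ω v) (subst (MvPolynomial.X 0) (L.bracket u w))
    - applyAt (MvPolynomial.X 0 + MvPolynomial.X 1) (ω.flip w)
        (subst (MvPolynomial.X 0) (L.bracket u v))

/-- The conditions on `ω` to define an extension, stated on `E` only. -/
structure IsTwist (ω : E →ₗ[F] E →ₗ[F] F[X] ⊗[F] M) : Prop where
  D_left : ∀ u v, ω (D δ u) v = -((Polynomial.X : F[X]) • ω u v)
  D_right : ∀ u v, ω u (D δ v) = dPlus δ Polynomial.X (ω u v)
  skew : ∀ u v, ω v u = -(adj δ (ω u v))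
  smul_right : ∀ u (a : A) v, ω u (a • v) = coeffSMul a (ω u v)
  jacobi : ∀ u v w, toValues δ M 3 (jacobiExpr R ω u v w) = 0

variable (ω : E →ₗ[F] E →ₗ[F] F[X] ⊗[F] M)

theorem lTensor_prod_ext {P : Type*} [CommRing P] [Algebra F P] {x y : P ⊗[F] (E × M)}
    (h₁ : (LinearMap.fst F E M).lTensor P x = (LinearMap.fst F E M).lTensor P y)
    (h₂ : (LinearMap.snd F E M).lTensor P x = (LinearMap.snd F E M).lTensor P y) : x = y := by
  have key : (LinearMap.id : P ⊗[F] (E × M) →ₗ[F] P ⊗[F] (E × M))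
      = (LinearMap.inl F E M).lTensor P ∘ₗ (LinearMap.fst F E M).lTensor P
        + (LinearMap.inr F E M).lTensor P ∘ₗ (LinearMap.snd F E M).lTensor P :=
    TensorProduct.ext' fun p z => by simp [← TensorProduct.tmul_add]
  refine (LinearMap.congr_fun key x).trans (Eq.trans ?_ (LinearMap.congr_fun key y).symm)
  simp only [LinearMap.add_apply, LinearMap.comp_apply, h₁, h₂]

theorem lTensor_fst_inl {P : Type*} [CommRing P] [Algebra F P] (z : P ⊗[F] E) :
    (LinearMap.fst F E M).lTensor P ((LinearMap.inl F E M).lTensor P z) = z := by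
  rw [← LinearMap.lTensor_comp_apply, LinearMap.fst_comp_inl, LinearMap.lTensor_id,
    LinearMap.id_apply]

theorem lTensor_snd_inr {P : Type*} [CommRing P] [Algebra F P] (z : P ⊗[F] M) :
    (LinearMap.snd F E M).lTensor P ((LinearMap.inr F E M).lTensor P z) = z := by
  rw [← LinearMap.lTensor_comp_apply, LinearMap.snd_comp_inr, LinearMap.lTensor_id,
    LinearMap.id_apply]

theorem lTensor_fst_inr {P : Type*} [CommRing P] [Algebra F P] (z : P ⊗[F] M) :
    (LinearMap.fst F E M).lTensor P ((LinearMap.inr F E M).lTensor P z) = 0 := by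
  rw [← LinearMap.lTensor_comp_apply, LinearMap.fst_comp_inr, LinearMap.lTensor_zero,
    LinearMap.zero_apply]

theorem lTensor_snd_inl {P : Type*} [CommRing P] [Algebra F P] (z : P ⊗[F] E) :
    (LinearMap.snd F E M).lTensor P ((LinearMap.inl F E M).lTensor P z) = 0 := by
  rw [← LinearMap.lTensor_comp_apply, LinearMap.snd_comp_inl, LinearMap.lTensor_zero,
    LinearMap.zero_apply]

theorem lTensor_fst_twistedBracket (x y : E × M) :
    (LinearMap.fst F E M).lTensor F[X] (twistedBracket R ω x y) = L.bracket x.1 y.1 := by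
  simp only [twistedBracket, LinearMap.mk₂_apply, map_add _ (LinearMap.lTensor _ _ _),
    lTensor_fst_inl, lTensor_fst_inr, add_zero]

theorem lTensor_snd_twistedBracket (x y : E × M) :
    (LinearMap.snd F E M).lTensor F[X] (twistedBracket R ω x y)
      = ω x.1 y.1 + R.act x.1 y.2 - adj δ (R.act y.1 x.2) := by
  simp only [twistedBracket, LinearMap.mk₂_apply, map_add _ (LinearMap.lTensor _ _ _),
    lTensor_snd_inl, lTensor_snd_inr, zero_add]

theorem lTensor_snd_comp_twistedBracket (x : E × M) :
    (LinearMap.snd F E M).lTensor F[X] ∘ₗ twistedBracket R ω x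
      = (ω x.1 - adj δ ∘ₗ R.act.flip x.2) ∘ₗ LinearMap.fst F E M
        + R.act x.1 ∘ₗ LinearMap.snd F E M := by
  refine LinearMap.ext fun y => ?_
  simp only [LinearMap.comp_apply, lTensor_snd_twistedBracket, LinearMap.add_apply,
    LinearMap.sub_apply, LinearMap.fst_apply, LinearMap.snd_apply, LinearMap.flip_apply]
  abel

theorem lTensor_snd_comp_twistedBracket_flip (y : E × M) :
    (LinearMap.snd F E M).lTensor F[X] ∘ₗ (twistedBracket R ω).flip y
      = (ω.flip y.1 + R.act.flip y.2) ∘ₗ LinearMap.fst F E M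
        - (adj δ ∘ₗ R.act y.1) ∘ₗ LinearMap.snd F E M := by
  refine LinearMap.ext fun x => ?_
  simp only [LinearMap.comp_apply, lTensor_snd_twistedBracket, LinearMap.add_apply,
    LinearMap.sub_apply, LinearMap.fst_apply, LinearMap.snd_apply, LinearMap.flip_apply]

theorem lTensor_fst_comp_twistedBracket (x : E × M) :
    (LinearMap.fst F E M).lTensor F[X] ∘ₗ twistedBracket R ω x
      = L.bracket x.1 ∘ₗ LinearMap.fst F E M :=
  LinearMap.ext fun y => lTensor_fst_twistedBracket R ω x y

theorem lTensor_fst_comp_twistedBracket_flip (y : E × M) :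
    (LinearMap.fst F E M).lTensor F[X] ∘ₗ (twistedBracket R ω).flip y
      = L.bracket.flip y.1 ∘ₗ LinearMap.fst F E M :=
  LinearMap.ext fun x => lTensor_fst_twistedBracket R ω x y

/-- The `M`-component of the Jacobi identity in `E ⊕ M`. -/
theorem toValues_twisted_jacobi (x y z : E × M) :
    toValues δ M 3 ((MvPolynomial.rename (R := F) Fin.castSucc).toLinearMap.rTensor M
      ((LinearMap.snd F E M).lTensor (MvPolynomial (Fin 2) F)
        (applyAt (MvPolynomial.X 0 : MvPolynomial (Fin 2) F) (twistedBracket R ω x)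
            (subst (MvPolynomial.X 1) (twistedBracket R ω y z))
          - applyAt (MvPolynomial.X 1 : MvPolynomial (Fin 2) F) (twistedBracket R ω y)
            (subst (MvPolynomial.X 0) (twistedBracket R ω x z))
          - applyAt (MvPolynomial.X 0 + MvPolynomial.X 1 : MvPolynomial (Fin 2) F)
            ((twistedBracket R ω).flip z) (subst (MvPolynomial.X 0) (twistedBracket R ω x y)))))
      = toValues δ M 3 (jacobiExpr R ω x.1 y.1 z.1) := by
  -- These decompositions of `λ₁ + λ₂ + λ₃` give, for each occurrence of `adj`, the complementary
  -- variable that replaces it.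
  have h1 : ((MvPolynomial.X 0 : MvPolynomial (Fin 3) F) + (MvPolynomial.X 1 + MvPolynomial.X 2))
    = lamSum F 3 := by rw [lamSum_three]; ring
  have h2 : ((MvPolynomial.X 1 : MvPolynomial (Fin 3) F) + (MvPolynomial.X 0 + MvPolynomial.X 2))
    = lamSum F 3 := by rw [lamSum_three]; ring
  have h3 : ((MvPolynomial.X 0 : MvPolynomial (Fin 3) F) + MvPolynomial.X 1 + MvPolynomial.X 2)
    = lamSum F 3 := lamSum_three.symm
  have h4 : ((MvPolynomial.X 1 : MvPolynomial (Fin 3) F) + MvPolynomial.X 0 + MvPolynomial.X 2)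
    = lamSum F 3 := by rw [lamSum_three]; ring
  have h5 : ((MvPolynomial.X 2 : MvPolynomial (Fin 3) F) + MvPolynomial.X 0 + MvPolynomial.X 1)
    = lamSum F 3 := by rw [lamSum_three]; ring
  simp only [map_sub, map_add, lTensor_applyAt, lTensor_snd_comp_twistedBracket,
    lTensor_snd_comp_twistedBracket_flip, applyAt_add, applyAt_sub,
    applyAt_comp (LinearMap.fst F E M), applyAt_comp (LinearMap.snd F E M), lTensor_subst,
    lTensor_fst_twistedBracket, lTensor_snd_twistedBracket, rTensor_applyAt, rTensor_subst,
    MvPolynomial.rename_X, Fin.castSucc_zero, Fin.castSucc_one, jacobiExpr]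
  rw [toValues_applyAt_adj h1 (R.act.flip x.2), toValues_applyAt_adj h2 (R.act.flip y.2)]
  -- Once every `adj` is gone, the action identity for brackets makes all terms in `x.2`, `y.2` and
  -- `z.2` cancel.
  simp only [toValues_applyAt_adj h3 (R.act z.1), toValues_applyAt_subst_adj h3 _ (R.act_D _),
    toValues_applyAt_subst_adj h4 _ (R.act_D _), toValues_applyAt_subst_adj h5 _ (R.act_D _),
    R.bracket_act_add, map_sub]
  abel

/-- Necessity is seen on pairs `(u, 0)`. For sufficiency the `E`-component of each axiom holds in
`L`, and in the `M`-component the terms from `M` are accounted for by the module axioms. -/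
theorem definesExtension_iff_isTwist : DefinesExtension R ω ↔ IsTwist R ω := by
  have hf : ∀ x : E × M, LinearMap.fst F E M (D δ x) = D δ (LinearMap.fst F E M x) :=
    fun _ => rfl
  have hs : ∀ x : E × M, LinearMap.snd F E M (D δ x) = D δ (LinearMap.snd F E M x) :=
    fun _ => rfl
  have hD1 : ∀ x : E × M, (D δ x).1 = D δ x.1 := fun _ => rfl
  have hD2 : ∀ x : E × M, (D δ x).2 = D δ x.2 := fun _ => rfl
  have ha : ∀ x : E × M, twistedAnchor L M x = L.anchor x.1 := fun _ => rfl
  constructor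
  · intro h
    refine ⟨fun u v => ?_, fun u v => ?_, fun u v => ?_, fun u a v => ?_, fun u v w => ?_⟩
    · have := congrArg ((LinearMap.snd F E M).lTensor F[X]) (h.bracket_D_left (u, 0) (v, 0))
      simpa [lTensor_snd_twistedBracket, lTensor_smul, hD1, hD2] using this
    · have := congrArg ((LinearMap.snd F E M).lTensor F[X]) (h.bracket_D_right (u, 0) (v, 0))
      simpa [lTensor_snd_twistedBracket, lTensor_dPlus _ hs, hD1, hD2] using this
    · have := congrArg ((LinearMap.snd F E M).lTensor F[X]) (h.skew (u, 0) (v, 0))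
      simpa [lTensor_snd_twistedBracket, lTensor_adj _ hs] using this
    · have := congrArg (((LinearMap.snd A E M).restrictScalars F).lTensor F[X])
        (h.bracket_smul (u, 0) a (v, 0))
      rw [map_add, lTensor_coeffSMul, lTensor_coeffMul] at this
      -- The `A`-linear projection restricted to `F` is definitionally the `F`-linear one used in
      -- the bracket formulas.
      change (LinearMap.snd F E M).lTensor F[X] _
        = coeffSMul a ((LinearMap.snd F E M).lTensor F[X] _) + coeffMul (0 : M) _ at this
      rw [coeffMul_zero] at this
      simpa [lTensor_snd_twistedBracket] using this
    · have := toValues_twisted_jacobi R ω (u, 0) (v, 0) (w, 0)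
      rw [h.jacobi, sub_self, map_zero, map_zero, map_zero] at this
      exact this.symm
  · intro h
    refine ⟨fun a u b => ?_, fun u b => ?_, fun u v => ?_, fun u v => ?_, fun u v => ?_,
      fun u v w => ?_, fun u a v => ?_, fun u v a => ?_⟩
    · exact L.isLCAd.anchor_smul a u.1 b
    · exact L.isLCAd.anchor_D u.1 b
    · apply lTensor_prod_ext
      · rw [map_neg, lTensor_smul, lTensor_fst_twistedBracket, lTensor_fst_twistedBracket]
        exact L.isLCAd.bracket_D_left _ _
      · rw [map_neg, lTensor_smul, lTensor_snd_twistedBracket, lTensor_snd_twistedBracket, hD1,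
          hD2, h.D_left, R.D_act, R.act_D, adj_dPlus, smul_sub, smul_add]
        abel
    · apply lTensor_prod_ext
      · rw [lTensor_dPlus _ hf, lTensor_fst_twistedBracket, lTensor_fst_twistedBracket]
        exact L.isLCAd.bracket_D_right _ _
      · rw [lTensor_dPlus _ hs, lTensor_snd_twistedBracket, lTensor_snd_twistedBracket, hD1,
          hD2, h.D_right, R.D_act, R.act_D, map_neg, adj_X_smul, map_sub, map_add]
        abel
    · apply lTensor_prod_ext
      · rw [map_neg, lTensor_adj _ hf, lTensor_fst_twistedBracket, lTensor_fst_twistedBracket]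
        exact L.isLCAd.skew _ _
      · rw [map_neg, lTensor_adj _ hs, lTensor_snd_twistedBracket, lTensor_snd_twistedBracket,
          h.skew, map_sub, map_add, adj_adj]
        abel
    · apply lTensor_prod_ext
      · simp only [map_sub, lTensor_applyAt, lTensor_fst_comp_twistedBracket,
          lTensor_fst_comp_twistedBracket_flip, applyAt_comp, lTensor_subst,
          lTensor_fst_twistedBracket]
        exact L.isLCAd.jacobi _ _ _
      -- The `M`-component of the Jacobi identity is tested in the value space, where it is
      -- `jacobiExpr`.
      · rw [← sub_eq_zero, ← map_sub]
        apply toValues_three_injective (δ := δ)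
        rw [toValues_twisted_jacobi, h.jacobi]
    · apply lTensor_prod_ext
      · have := lTensor_coeffSMul (F := F) (P := F[X]) (LinearMap.fst A E M) a
          (twistedBracket R ω u v)
        have h' := lTensor_coeffMul (F := F) (P := F[X]) (LinearMap.fst A E M) v
          ((twistedAnchor L M u).1 a)
        change (LinearMap.fst F E M).lTensor F[X] _
          = coeffSMul a ((LinearMap.fst F E M).lTensor F[X] _) at this
        change (LinearMap.fst F E M).lTensor F[X] _ = _ at h'
        rw [map_add, this, h', lTensor_fst_twistedBracket, lTensor_fst_twistedBracket]
        exact L.isLCAd.bracket_smul _ _ _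
      · have := lTensor_coeffSMul (F := F) (P := F[X]) (LinearMap.snd A E M) a
          (twistedBracket R ω u v)
        have h' := lTensor_coeffMul (F := F) (P := F[X]) (LinearMap.snd A E M) v
          ((twistedAnchor L M u).1 a)
        change (LinearMap.snd F E M).lTensor F[X] _
          = coeffSMul a ((LinearMap.snd F E M).lTensor F[X] _) at this
        change (LinearMap.snd F E M).lTensor F[X] _ = _ at h'
        rw [map_add, this, h', lTensor_snd_twistedBracket, lTensor_snd_twistedBracket, ha,
          Prod.smul_fst, Prod.smul_snd, h.smul_right, R.act_smul, R.smul_act, adj_shift₁, map_sub,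
          map_add]
        change _ = _ + coeffMul v.2 _
        abel
    · have := L.isLCAd.anchor_bracket u.1 v.1 a
      rw [← lTensor_fst_twistedBracket R ω u v, ← lTensor_subst, ← applyAt_comp] at this
      exact this

end Twisted

/-! ### Cochains and differentials in degrees 1 and 2 -/

section Cocycles

variable {F : Type*} [Field F] {A : Type*} [CommRing A] [Algebra F A] {δ : Derivation F A A}
  {E : Type*} [AddCommGroup E] [Module F E] [Module A E] [IsScalarTower F A E] [DiffModule δ E]
  {M : Type*} [AddCommGroup M] [Module F M] [Module A M] [IsScalarTower F A M] [DiffModule δ M]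
  {L : LCAd δ E} (R : LCAdModule L M)

theorem toCochain_apply (ω : E →ₗ[F] E →ₗ[F] F[X] ⊗[F] M) (u : Fin 2 → E) :
    toCochain (δ := δ) ω u = firstValue δ M (ω (u 0) (u 1)) := rfl

theorem permValues_swap_firstValue (f : F[X] ⊗[F] M) :
    permValues δ (Equiv.swap 0 1) (firstValue δ M f) = firstValue δ M (adj δ f) := by
  rw [← toValues_subst_one, firstValue_apply, permValues, substValues_toValues, rTensor_subst,
    MvPolynomial.rename_X, Equiv.swap_apply_left]

theorem permValues_one {k : ℕ} (v : Values δ M k) :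
    permValues δ (1 : Equiv.Perm (Fin k)) v = v := by
  obtain ⟨x, rfl⟩ := toValues_surjective δ M k v
  rw [permValues, substValues_toValues]
  have h : (MvPolynomial.rename (R := F) (1 : Equiv.Perm (Fin k))) = AlgHom.id F _ := by
    ext i
    simp
  rw [h, AlgHom.toLinearMap_id, LinearMap.rTensor_id, LinearMap.id_apply]

/-- The cochain conditions are transported through the bijection `firstValue`: multiplication by
`λ₂` becomes `-(∂ + λ)`, and the transposition becomes `adj`. -/
theorem toCochain_mem_cochains_iff (ω : E →ₗ[F] E →ₗ[F] F[X] ⊗[F] M) :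
    toCochain ω ∈ cochains δ E M 2 ↔
      (∀ u v, ω (D δ u) v = -((Polynomial.X : F[X]) • ω u v)) ∧
      (∀ u v, ω u (D δ v) = dPlus δ Polynomial.X (ω u v)) ∧
      (∀ u v, ω v u = -(adj δ (ω u v))) ∧
      (∀ u (a : A) v, ω u (a • v) = coeffSMul a (ω u v)) := by
  constructor
  · rintro ⟨h1, h2, h3⟩
    refine ⟨fun u v => ?_, fun u v => ?_, fun u v => ?_, fun u a v => ?_⟩ <;>
      apply firstValue_injective (δ := δ)
    · have := h2 ![u, v] 0
      rw [toCochain_apply, toCochain_apply, mulValues_firstValue_zero, ← map_neg] at this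
      simpa using this
    · have := h2 ![u, v] 1
      rw [toCochain_apply, toCochain_apply, mulValues_firstValue_one, ← map_neg, neg_neg] at this
      simpa using this
    · have := h3 ![v, u] (Equiv.swap 0 1)
      rw [toCochain_apply, toCochain_apply, permValues_swap_firstValue] at this
      simpa using this
    · have := h1 ![u, v] 1 a
      rw [toCochain_apply, toCochain_apply, shiftValues_firstValue_one] at this
      simpa using this
  · rintro ⟨h1, h2, h3, h4⟩
    -- The rule for `A` in the first argument follows from the second by skewsymmetry.
    have h5 : ∀ (a : A) u v, ω (a • u) v = shift₁ δ a (ω u v) := fun a u v => by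
      rw [h3 v, h4, h3 u v, map_neg, map_neg, neg_neg, adj_coeffSMul, adj_adj]
    refine ⟨fun u i a => ?_, fun u i => ?_, fun u π => ?_⟩
    · rw [toCochain_apply, toCochain_apply]
      fin_cases i
      · refine Eq.trans ?_ (shiftValues_firstValue_zero _ _).symm
        simp [h5]
      · refine Eq.trans ?_ (shiftValues_firstValue_one _ _).symm
        simp [h4]
    · rw [toCochain_apply, toCochain_apply]
      fin_cases i
      · refine Eq.trans ?_ (congrArg Neg.neg (mulValues_firstValue_zero _)).symm
        simp [h1]
      · refine Eq.trans ?_ (congrArg Neg.neg (mulValues_firstValue_one _)).symm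
        simp [h2]
    · have hπ : ∀ π : Equiv.Perm (Fin 2), π = 1 ∨ π = Equiv.swap 0 1 := by decide
      rw [toCochain_apply, toCochain_apply]
      rcases hπ π with rfl | rfl
      · simp [permValues_one]
      · rw [permValues_swap_firstValue, h3 (u 1)]
        simp

theorem actValues_toValues {k : ℕ} (i : Fin (k + 1)) (u : E)
    (x : MvPolynomial (Fin k) F ⊗[F] M) :
    actValues R i u (toValues δ M k x) = toValues δ M (k + 1)
      (applyAt (MvPolynomial.X i) (R.act u)
        ((MvPolynomial.rename (R := F) i.succAbove).toLinearMap.rTensor M x)) := rfl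

theorem dAct_apply (k : ℕ) (φ : MultilinearMap F (fun _ : Fin k => E) (Values δ M k))
    (u : Fin (k + 1) → E) :
    dAct R k φ u
      = ∑ i : Fin (k + 1), (-1 : ℤ) ^ (i : ℕ) • actValues R i (u i) (φ (i.removeNth u)) := by
  simp [dAct, LinearMap.sum_apply]

theorem dBracket_apply (k : ℕ)
    (φ : MultilinearMap F (fun _ : Fin (k + 1) => E) (Values δ M (k + 1)))
    (u : Fin (k + 2) → E) :
    dBracket L k φ u = ∑ j : Fin (k + 2), ∑ i : Fin (k + 1),
      if i.castSucc < j then (-1 : ℤ) ^ ((i : ℕ) + (j : ℕ)) •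
        insertBracket j i φ (L.bracket (j.removeNth u i) (u j)) (i.removeNth (j.removeNth u))
      else 0 := by
  simp only [dBracket, sum_apply, LinearMap.sum_apply]
  refine Finset.sum_congr rfl fun j _ => Finset.sum_congr rfl fun i _ => ?_
  split_ifs <;> simp

theorem insertBracket_tmul {k : ℕ} (j : Fin (k + 2)) (i : Fin (k + 1))
    (φ : MultilinearMap F (fun _ : Fin (k + 1) => E) (Values δ M (k + 1))) (p : F[X]) (c : E)
    (w : Fin k → E) :
    insertBracket j i φ (p ⊗ₜ[F] c) w
      = mulValues δ (k + 2) (Polynomial.aeval (MvPolynomial.X (j.succAbove i)) p)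
        (mergeValues j i (φ (Fin.cons c w))) := rfl

/-- The bracket sits in the first slot, whose variable is merged to `λ_i + λ_j`, while its own
polynomial part is evaluated at `λ_i`. -/
theorem insertBracket_toCochain (ω : E →ₗ[F] E →ₗ[F] F[X] ⊗[F] M) (j : Fin 3) (i : Fin 2)
    (f : F[X] ⊗[F] E) (w : Fin 1 → E) :
    insertBracket j i (toCochain (δ := δ) ω) f w = toValues δ M 3
      (applyAt (MvPolynomial.X (j.succAbove i) + MvPolynomial.X j) (ω.flip (w 0))
        (subst (MvPolynomial.X (j.succAbove i)) f)) := by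
  induction f with
  | zero => simp
  | add x y hx hy => simp only [map_add, add_apply, hx, hy]
  | tmul p c =>
    rw [insertBracket_tmul, toCochain_apply, firstValue_apply, mergeValues, substValues_toValues,
      rTensor_subst, mulValues_toValues, subst_tmul, applyAt_tmul]
    simp

theorem d_two_toCochain (ω : E →ₗ[F] E →ₗ[F] F[X] ⊗[F] M)
    (h : ∀ u v, ω v u = -(adj δ (ω u v))) (u : Fin 3 → E) :
    d R 2 (toCochain ω) u = toValues δ M 3 (jacobiExpr R ω (u 0) (u 1) (u 2)) := by
  -- The differential puts every bracket in the first argument of `ω`, whereas `jacobiExpr` has two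
  -- of the three in the second; skewsymmetry reconciles them.
  have hflip : ∀ v, ω.flip v = -(adj δ ∘ₗ ω v) := fun v => LinearMap.ext fun u => h v u
  have h1 : ((MvPolynomial.X 0 : MvPolynomial (Fin 3) F) + MvPolynomial.X 2 + MvPolynomial.X 1)
    = lamSum F 3 := by rw [lamSum_three]; ring
  have h2 : ((MvPolynomial.X 1 : MvPolynomial (Fin 3) F) + MvPolynomial.X 2 + MvPolynomial.X 0)
    = lamSum F 3 := by rw [lamSum_three]; ring
  have hact : ∀ (i : Fin 3) (x : E) (f : F[X] ⊗[F] M), actValues R i x (firstValue δ M f)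
      = toValues δ M 3 (applyAt (MvPolynomial.X i) (R.act x)
        (subst (MvPolynomial.X (i.succAbove 0)) f)) := fun i x f => by
    rw [firstValue_apply, actValues_toValues, rTensor_subst, MvPolynomial.rename_X]
  change dAct R 2 _ u + dBracket L 1 _ u = _
  rw [dAct_apply, dBracket_apply, Fin.sum_univ_three, Fin.sum_univ_three, Fin.sum_univ_two,
    Fin.sum_univ_two, Fin.sum_univ_two, if_neg (by decide), if_neg (by decide),
    if_pos (by decide), if_neg (by decide), if_pos (by decide), if_pos (by decide)]
  simp only [toCochain_apply, hact, insertBracket_toCochain, Fin.removeNth_apply]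
  -- The zeros are the index pairs that violate `i < j`. The signs are for indices counted from 0.
  change (1 : ℤ) • toValues δ M 3 (applyAt (MvPolynomial.X 0) (R.act (u 0))
        (subst (MvPolynomial.X 1) (ω (u 1) (u 2))))
      + (-1 : ℤ) • toValues δ M 3 (applyAt (MvPolynomial.X 1) (R.act (u 1))
        (subst (MvPolynomial.X 0) (ω (u 0) (u 2))))
      + (1 : ℤ) • toValues δ M 3 (applyAt (MvPolynomial.X 2) (R.act (u 2))
        (subst (MvPolynomial.X 0) (ω (u 0) (u 1))))
      + (0 + 0 + ((-1 : ℤ) • toValues δ M 3 (applyAt (MvPolynomial.X 0 + MvPolynomial.X 1)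
          (ω.flip (u 2)) (subst (MvPolynomial.X 0) (L.bracket (u 0) (u 1)))) + 0)
        + ((1 : ℤ) • toValues δ M 3 (applyAt (MvPolynomial.X 0 + MvPolynomial.X 2)
          (ω.flip (u 1)) (subst (MvPolynomial.X 0) (L.bracket (u 0) (u 2))))
        + (-1 : ℤ) • toValues δ M 3 (applyAt (MvPolynomial.X 1 + MvPolynomial.X 2)
          (ω.flip (u 0)) (subst (MvPolynomial.X 1) (L.bracket (u 1) (u 2)))))) = _
  rw [hflip (u 0), hflip (u 1), applyAt_neg, applyAt_neg, map_neg, map_neg,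
    toValues_applyAt_adj h1, toValues_applyAt_adj h2]
  simp only [jacobiExpr, map_add, map_sub]
  abel

theorem toCochain_mem_cocycles_iff (ω : E →ₗ[F] E →ₗ[F] F[X] ⊗[F] M) :
    toCochain ω ∈ cocycles R 2 ↔ DefinesExtension R ω := by
  rw [definesExtension_iff_isTwist, cocycles, Submodule.mem_inf, toCochain_mem_cochains_iff,
    LinearMap.mem_ker]
  constructor
  · rintro ⟨⟨h1, h2, h3, h4⟩, h5⟩
    refine ⟨h1, h2, h3, h4, fun u v w => ?_⟩
    exact (d_two_toCochain R ω h3 ![u, v, w]).symm.trans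
      (congrArg (fun φ => φ ![u, v, w]) h5)
  · intro h
    refine ⟨⟨h.D_left, h.D_right, h.skew, h.smul_right⟩, MultilinearMap.ext fun u => ?_⟩
    rw [d_two_toCochain R ω h.skew, h.jacobi]
    rfl

theorem toCochain_injective :
    Function.Injective (toCochain (δ := δ) : (E →ₗ[F] E →ₗ[F] F[X] ⊗[F] M) →ₗ[F] _) := by
  intro ω η h
  refine LinearMap.ext₂ fun u v => firstValue_injective (δ := δ) ?_
  exact congrArg (fun φ => φ ![u, v]) h

theorem toCochain_surjective :
    Function.Surjective (toCochain (δ := δ) : (E →ₗ[F] E →ₗ[F] F[X] ⊗[F] M) →ₗ[F] _) := by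
  intro φ
  let e := LinearEquiv.ofBijective (firstValue δ M) ⟨firstValue_injective, firstValue_surjective⟩
  have hupd : ∀ u v : E, Function.update ![u, 0] 1 v = ![u, v] := fun u v => by
    ext i
    fin_cases i <;> simp
  refine ⟨LinearMap.mk₂ F (fun u v => e.symm (φ ![u, v])) (fun u u' v => ?_) (fun c u v => ?_)
    (fun u v v' => ?_) (fun c u v => ?_), MultilinearMap.ext fun u => ?_⟩
  · rw [← map_add]
    exact congrArg e.symm (φ.cons_add ![v] u u')
  · rw [← map_smul]
    exact congrArg e.symm (φ.cons_smul ![v] c u)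
  · rw [← map_add]
    have := φ.map_update_add ![u, 0] 1 v v'
    rw [hupd, hupd, hupd] at this
    exact congrArg e.symm this
  · rw [← map_smul]
    have := φ.map_update_smul ![u, 0] 1 c v
    rw [hupd, hupd] at this
    exact congrArg e.symm this
  · rw [toCochain_apply]
    refine (e.apply_symm_apply (φ ![u 0, u 1])).trans (congrArg φ ?_)
    ext i
    fin_cases i <;> rfl

/-! ### 1-cochains -/

/-- The 1-cochain given by a linear map `g : E → M`. -/
def linearCochain (g : E →ₗ[F] M) : MultilinearMap F (fun _ : Fin 1 => E) (Values δ M 1) :=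
  (constValue δ M ∘ₗ g).compMultilinearMap
    (MultilinearMap.ofSubsingleton F E E (0 : Fin 1) LinearMap.id)

theorem linearCochain_apply (g : E →ₗ[F] M) (u : Fin 1 → E) :
    linearCochain (δ := δ) g u = constValue δ M (g (u 0)) := rfl

theorem linearCochain_surjective :
    Function.Surjective (linearCochain (δ := δ) : (E →ₗ[F] M) → _) := by
  intro φ
  let e := LinearEquiv.ofBijective (constValue δ M) ⟨constValue_injective, constValue_surjective⟩
  refine ⟨e.symm.toLinearMap ∘ₗ (MultilinearMap.ofSubsingleton F E (Values δ M 1) (0 : Fin 1)).symm φ,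
    MultilinearMap.ext fun u => ?_⟩
  rw [linearCochain_apply]
  refine (e.apply_symm_apply _).trans ?_
  refine congrArg φ ?_
  ext i
  fin_cases i
  rfl

/-- Through `constValue` the variable `λ₁` acts on `M` as `-∂` and the shift by `a` is
multiplication by `a`, so the cochain conditions say that `g` is `A[∂]`-linear. -/
theorem linearCochain_mem_cochains_iff (g : E →ₗ[F] M) :
    linearCochain g ∈ cochains δ E M 1 ↔
      (∀ (a : A) u, g (a • u) = a • g u) ∧ ∀ u, g (D δ u) = D δ (g u) := by
  constructor
  · rintro ⟨h1, h2, -⟩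
    refine ⟨fun a u => ?_, fun u => ?_⟩ <;> apply constValue_injective (δ := δ)
    · have := h1 (fun _ => u) 0 a
      rw [linearCochain_apply, linearCochain_apply, shiftValues_constValue] at this
      simpa using this
    · have := h2 (fun _ => u) 0
      rw [linearCochain_apply, linearCochain_apply, mulValues_constValue, neg_neg] at this
      simpa using this
  · rintro ⟨h1, h2⟩
    refine ⟨fun u i a => ?_, fun u i => ?_, fun u π => ?_⟩
    · obtain rfl := Subsingleton.elim i 0
      rw [linearCochain_apply, linearCochain_apply, shiftValues_constValue]
      simp [h1]
    · obtain rfl := Subsingleton.elim i 0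
      rw [linearCochain_apply, linearCochain_apply, mulValues_constValue]
      simp [h2]
    · obtain rfl := Subsingleton.elim π 1
      simp [permValues_one]

/-- The form `u_λ g(v) - (|_{x=∂} v_{-λ-x} g(u)) - g([u_λ v])`. -/
def coboundaryForm (g : E →ₗ[F] M) : E →ₗ[F] E →ₗ[F] F[X] ⊗[F] M :=
  LinearMap.mk₂ F
    (fun u v => R.act u (g v) - adj δ (R.act v (g u)) - g.lTensor F[X] (L.bracket u v))
    (by intros; simp only [map_add, LinearMap.add_apply]; abel)
    (by intros; simp only [map_smul, LinearMap.smul_apply, smul_sub])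
    (by intros; simp only [map_add, LinearMap.add_apply]; abel)
    (by intros; simp only [map_smul, LinearMap.smul_apply, smul_sub])

theorem coboundaryForm_apply (g : E →ₗ[F] M) (u v : E) :
    coboundaryForm R g u v
      = R.act u (g v) - adj δ (R.act v (g u)) - g.lTensor F[X] (L.bracket u v) := rfl

/-- A constant representative does not involve the merged variable `λ₁ + λ₂`, so only the polynomial
part of `f`, taken at `λ₁`, survives. -/
theorem insertBracket_linearCochain (g : E →ₗ[F] M) (f : F[X] ⊗[F] E) (w : Fin 0 → E) :
    insertBracket (1 : Fin 2) (0 : Fin 1) (linearCochain (δ := δ) g) f w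
      = firstValue δ M (g.lTensor F[X] f) := by
  induction f with
  | zero => simp
  | add x y hx hy => simp only [map_add, add_apply, hx, hy]
  | tmul p c =>
    rw [insertBracket_tmul, linearCochain_apply, constValue_apply, mergeValues,
      substValues_toValues, mulValues_toValues, firstValue_apply]
    simp [TensorProduct.smul_tmul']

theorem d_one_linearCochain (g : E →ₗ[F] M) :
    d R 1 (linearCochain g) = toCochain (coboundaryForm R g) := by
  refine MultilinearMap.ext fun u => ?_
  have hact : ∀ (i : Fin 2) (x : E) (m : M), actValues R i x (constValue δ M m)
      = toValues δ M 2 (subst (MvPolynomial.X i) (R.act x m)) := fun i x m => by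
    rw [constValue_apply, actValues_toValues, LinearMap.rTensor_tmul, AlgHom.toLinearMap_apply,
      map_one, applyAt_tmul, one_smul]
  change dAct R 1 _ u + dBracket L 0 _ u = _
  rw [dAct_apply, dBracket_apply, Fin.sum_univ_two, Fin.sum_univ_two, Fin.sum_univ_one,
    Fin.sum_univ_one, if_neg (by decide), if_pos (by decide)]
  simp only [linearCochain_apply, hact]
  change (1 : ℤ) • firstValue δ M (R.act (u 0) (g (u 1)))
    + (-1 : ℤ) • toValues δ M 2 (subst (MvPolynomial.X 1) (R.act (u 1) (g (u 0))))
    + (0 + (-1 : ℤ) • insertBracket (1 : Fin 2) (0 : Fin 1) (linearCochain (δ := δ) g)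
        (L.bracket (u 0) (u 1)) _)
      = firstValue δ M (coboundaryForm R g (u 0) (u 1))
  -- The term in `λ₂` is rewritten in `λ₁`, which produces the `adj` in `coboundaryForm`.
  rw [insertBracket_linearCochain, toValues_subst_one, coboundaryForm_apply, map_sub, map_sub]
  abel

theorem toCochain_sub_mem_coboundaries_iff (ω η : E →ₗ[F] E →ₗ[F] F[X] ⊗[F] M) :
    toCochain ω - toCochain η ∈ coboundaries R 2 ↔
      ∃ g : E →ₗ[F] M, (∀ (a : A) u, g (a • u) = a • g u) ∧
        (∀ u, g (D δ u) = D δ (g u)) ∧ ω = η + coboundaryForm R g := by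
  constructor
  · rintro ⟨ψ, hψ, h⟩
    obtain ⟨g, rfl⟩ := linearCochain_surjective ψ
    obtain ⟨h1, h2⟩ := (linearCochain_mem_cochains_iff g).1 hψ
    refine ⟨g, h1, h2, toCochain_injective (δ := δ) ?_⟩
    rw [map_add, ← d_one_linearCochain, h, add_sub_cancel]
  · rintro ⟨g, h1, h2, rfl⟩
    refine ⟨linearCochain g, (linearCochain_mem_cochains_iff g).2 ⟨h1, h2⟩, ?_⟩
    rw [d_one_linearCochain, map_add, add_sub_cancel_left]

end Cocycles

/-! ### Equivalences as shears, and the form of a general split extension -/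

section Classification

universe uF uA uE uM

variable {F : Type uF} [Field F] {A : Type uA} [CommRing A] [Algebra F A] {δ : Derivation F A A}
  {E : Type uE} [AddCommGroup E] [Module F E] [Module A E] [IsScalarTower F A E] [DiffModule δ E]
  {M : Type uM} [AddCommGroup M] [Module F M] [Module A M] [IsScalarTower F A M]
  [DiffModule δ M] {L : LCAd δ E} (R : LCAdModule L M)

/-- The automorphism `u + m ↦ u + m + g(u)` of `E ⊕ M`. -/
def shear (g : E →ₗ[A] M) : E × M →ₗ[A] E × M :=
  (LinearMap.fst A E M).prod (LinearMap.snd A E M + g ∘ₗ LinearMap.fst A E M)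

theorem shear_apply (g : E →ₗ[A] M) (x : E × M) : shear g x = (x.1, x.2 + g x.1) := rfl

theorem shear_bijective (g : E →ₗ[A] M) : Function.Bijective (shear g) := by
  refine Function.bijective_iff_has_inverse.2 ⟨shear (-g), fun x => ?_, fun x => ?_⟩ <;>
    simp [shear_apply]

theorem shear_D {g : E →ₗ[A] M} (hg : ∀ u, g (D δ u) = D δ (g u)) (x : E × M) :
    shear g (D δ x) = D δ (shear g x) := by
  change (D δ x.1, D δ x.2 + g (D δ x.1)) = (D δ x.1, D δ (x.2 + g x.1))
  rw [hg, map_add]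

/-- The shear by `g` is compatible with the brackets defined by `ω` and `η` if and only if
`ω` is the sum of `η` and the coboundary of `g`. -/
theorem shear_bracket_iff (g : E →ₗ[A] M) (ω η : E →ₗ[F] E →ₗ[F] F[X] ⊗[F] M) :
    (∀ x y, twistedBracket R η (shear g x) (shear g y)
      = ((shear g).restrictScalars F).lTensor F[X] (twistedBracket R ω x y)) ↔
      ω = η + coboundaryForm R (g.restrictScalars F) := by
  have h1 : LinearMap.fst F E M ∘ₗ (shear g).restrictScalars F = LinearMap.fst F E M := rfl
  have h2 : LinearMap.snd F E M ∘ₗ (shear g).restrictScalars F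
      = LinearMap.snd F E M + g.restrictScalars F ∘ₗ LinearMap.fst F E M := rfl
  have h3 : ∀ x y, (LinearMap.snd F E M).lTensor F[X]
      (((shear g).restrictScalars F).lTensor F[X] (twistedBracket R ω x y))
      = ω x.1 y.1 + R.act x.1 y.2 - adj δ (R.act y.1 x.2)
        + (g.restrictScalars F).lTensor F[X] (L.bracket x.1 y.1) := fun x y => by
    rw [← LinearMap.lTensor_comp_apply, h2, LinearMap.lTensor_add, LinearMap.add_apply,
      LinearMap.lTensor_comp_apply, lTensor_snd_twistedBracket, lTensor_fst_twistedBracket]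
  constructor
  · intro h
    refine LinearMap.ext₂ fun u v => ?_
    -- Pairs from `E` already determine the relation between `ω` and `η`.
    have := congrArg ((LinearMap.snd F E M).lTensor F[X]) (h (u, 0) (v, 0))
    rw [h3, lTensor_snd_twistedBracket] at this
    simp only [shear_apply, zero_add, map_zero, add_zero, sub_zero] at this
    rw [LinearMap.add_apply, LinearMap.add_apply, coboundaryForm_apply,
      LinearMap.restrictScalars_apply, LinearMap.restrictScalars_apply, ← add_sub_assoc,
      ← add_sub_assoc, eq_sub_iff_add_eq]
    exact this.symm
  · intro h x y
    apply lTensor_prod_ext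
    · rw [← LinearMap.lTensor_comp_apply, h1, lTensor_fst_twistedBracket,
        lTensor_fst_twistedBracket]
      rfl
    · have := LinearMap.congr_fun (LinearMap.congr_fun h x.1) y.1
      rw [LinearMap.add_apply, LinearMap.add_apply, coboundaryForm_apply,
        LinearMap.restrictScalars_apply, LinearMap.restrictScalars_apply] at this
      rw [h3, lTensor_snd_twistedBracket, this]
      simp only [shear_apply, map_add]
      abel

/-- A map that is the identity on `M` and on `E` is the shear by the `M`-component `g` of its
restriction to `E`. Its bracket condition is `shear_bracket_iff`. -/
theorem extOf_equivalent_iff (ω η : E →ₗ[F] E →ₗ[F] F[X] ⊗[F] M) (hω : DefinesExtension R ω)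
    (hη : DefinesExtension R η) :
    (extOf R ω hω).1.Equivalent (extOf R η hη).1 ↔
      toCochain ω - toCochain η ∈ coboundaries R 2 := by
  rw [toCochain_sub_mem_coboundaries_iff]
  constructor
  · rintro ⟨χ, -, h1, h2⟩
    let X : E × M →ₗ[A] E × M := χ.toLinearMap
    let g : E →ₗ[A] M := LinearMap.snd A E M ∘ₗ X ∘ₗ LinearMap.inl A E M
    have hX : X = shear g := by
      refine LinearMap.ext fun x => Prod.ext (h2 x) ?_
      have h3 : X (0, x.2) = (0, x.2) := h1 x.2
      have h4 : X x = X (x.1, 0) + X (0, x.2) := by rw [← map_add]; simp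
      rw [h4, h3, shear_apply]
      exact add_comm _ _
    refine ⟨g.restrictScalars F, fun a u => map_smul g a u, fun u => ?_, ?_⟩
    · have := χ.map_D ((u, 0) : E × M)
      have h5 : X (D δ ((u, 0) : E × M)) = D δ (X (u, 0)) := this
      have h6 : (D δ ((u, 0) : E × M)) = (D δ u, 0) := Prod.ext rfl (map_zero (D δ (M := M)))
      rw [h6] at h5
      exact congrArg Prod.snd h5
    · rw [← shear_bracket_iff]
      intro x y
      have := χ.map_bracket x y
      change twistedBracket R η (X x) (X y)
        = (X.restrictScalars F).lTensor F[X] (twistedBracket R ω x y) at this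
      rwa [hX] at this
  · rintro ⟨g, h1, h2, h⟩
    let g' : E →ₗ[A] M := { g with map_smul' := h1 }
    refine ⟨{ toLinearMap := shear g'
              map_D := shear_D h2
              map_bracket := (shear_bracket_iff R g' ω η).2 h
              map_anchor := fun _ => rfl }, shear_bijective g', fun m => ?_, fun _ => rfl⟩
    change shear g' (0, m) = (0, m)
    simp [shear_apply]

theorem definesExtension_zero : DefinesExtension R 0 := by
  rw [← toCochain_mem_cocycles_iff, map_zero]
  exact zero_mem _

/-- No computation of `d ∘ d` is needed: if `ω = dg`, the shear by `g` carries the bracket of `ω` to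
that of the semidirect sum, so `ω` defines an extension and is a cocycle. -/
theorem coboundaries_le_cocycles : coboundaries R 2 ≤ cocycles R 2 := by
  intro φ hφ
  obtain ⟨ω, rfl⟩ := toCochain_surjective (δ := δ) φ
  rw [toCochain_mem_cocycles_iff]
  obtain ⟨g, h1, h2, h⟩ := (toCochain_sub_mem_coboundaries_iff R ω 0).1
    (by rwa [map_zero, sub_zero])
  let g' : E →ₗ[A] M := { g with map_smul' := h1 }
  refine (definesExtension_zero R).of_injective (shear g') (shear_bijective g').1 (shear_D h2)
    (fun x y => ((shear_bracket_iff R g' ω 0).2 h x y).symm) fun _ => rfl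

/-- Every `A[∂]`-split abelian extension is equivalent to one of the form `E ⊕ M`. -/
theorem exists_extOf_equivalent (X : SplitExt R) :
    ∃ (ω : E →ₗ[F] E →ₗ[F] F[X] ⊗[F] M) (h : DefinesExtension R ω),
      (extOf R ω h).1.Equivalent X.1 := by
  obtain ⟨X, ⟨s, hsD, hs⟩, hR⟩ := X
  let p : X.carrier →ₗ[A] E := X.p.toLinearMap
  let i : M →ₗ[A] X.carrier := X.ι.toLinearMap
  have hpi : ∀ m, p (i m) = 0 := fun m => (X.exact (i m)).2 ⟨m, rfl⟩
  let χ : E × M →ₗ[A] X.carrier := s.coprod i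
  have hχ : ∀ x, χ x = s x.1 + i x.2 := fun x => LinearMap.coprod_apply _ _ _
  have hpχ : ∀ x, p (χ x) = x.1 := fun x => by
    rw [hχ, map_add, hpi, add_zero]
    exact hs x.1
  have hbij : Function.Bijective χ := by
    constructor
    · rw [← LinearMap.ker_eq_bot, LinearMap.ker_eq_bot']
      intro x hx
      have h1 : x.1 = 0 := by rw [← hpχ, hx, map_zero]
      rw [hχ, h1, map_zero, zero_add] at hx
      exact Prod.ext h1 (X.ι_injective (hx.trans (map_zero i).symm))
    · intro y
      -- Subtracting `s(p(y))` moves `y` into the kernel of `p`, hence into the image of `M`.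
      obtain ⟨m, hm⟩ := (X.exact (y - s (p y))).1 (by
        rw [map_sub, sub_eq_zero]
        exact (hs (p y)).symm)
      refine ⟨(p y, m), ?_⟩
      rw [hχ]
      exact (congrArg (s (p y) + ·) hm).trans (add_sub_cancel _ _)
  have hχD : ∀ x, χ (D δ x) = D δ (χ x) := fun x => by
    rw [hχ, hχ, map_add]
    exact congrArg₂ (· + ·) (hsD x.1) (X.ι.map_D x.2)
  let e : (E × M) ≃ₗ[A] X.carrier := LinearEquiv.ofBijective χ hbij
  let r : X.carrier →ₗ[F] M :=
    LinearMap.snd F E M ∘ₗ e.symm.toLinearMap.restrictScalars F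
  -- Coefficientwise decomposition along `s` and `i`; `r` is the projection to `M` that it
  -- determines.
  have hdec : ∀ z : F[X] ⊗[F] X.carrier, z
      = (s.restrictScalars F).lTensor F[X] ((p.restrictScalars F).lTensor F[X] z)
        + (i.restrictScalars F).lTensor F[X] (r.lTensor F[X] z) := by
    intro z
    have key : (LinearMap.id : X.carrier →ₗ[F] X.carrier)
        = s.restrictScalars F ∘ₗ p.restrictScalars F + i.restrictScalars F ∘ₗ r := by
      refine LinearMap.ext fun y => ?_
      obtain ⟨x, rfl⟩ := hbij.2 y
      have : e.symm (χ x) = x := e.symm_apply_apply x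
      change χ x = s (p (χ x)) + i (e.symm (χ x)).2
      rw [this, hpχ, hχ]
    rw [← LinearMap.lTensor_comp_apply, ← LinearMap.lTensor_comp_apply, ← LinearMap.add_apply,
      ← LinearMap.lTensor_add, ← key, LinearMap.lTensor_id, LinearMap.id_apply]
  -- The failure of `s` to preserve brackets: the `M`-component of `[s(u)_λ s(v)]`.
  let ω : E →ₗ[F] E →ₗ[F] F[X] ⊗[F] M :=
    ((X.lcad.bracket.compl₁₂ (s.restrictScalars F) (s.restrictScalars F)).compr₂
      (r.lTensor F[X]))
  have hω : ∀ u v, ω u v = r.lTensor F[X] (X.lcad.bracket (s u) (s v)) := fun _ _ => rfl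
  have hp : ∀ x y, (p.restrictScalars F).lTensor F[X] (X.lcad.bracket x y)
      = L.bracket (p x) (p y) := fun x y => (X.p.map_bracket x y).symm
  have hps : ∀ u, p (s u) = u := hs
  have hact : ∀ x m, X.lcad.bracket x (i m)
      = (i.restrictScalars F).lTensor F[X] (R.act (p x) m) := hR
  have hiD : ∀ m, i.restrictScalars F (D δ m) = D δ (i.restrictScalars F m) := X.ι.map_D
  have hB : ∀ x y, (χ.restrictScalars F).lTensor F[X] (twistedBracket R ω x y)
      = X.lcad.bracket (χ x) (χ y) := by
    intro x y
    have h1 : χ.restrictScalars F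
        = s.restrictScalars F ∘ₗ LinearMap.fst F E M
          + i.restrictScalars F ∘ₗ LinearMap.snd F E M :=
      LinearMap.ext hχ
    rw [h1, LinearMap.lTensor_add, LinearMap.add_apply, LinearMap.lTensor_comp_apply,
      LinearMap.lTensor_comp_apply, lTensor_fst_twistedBracket, lTensor_snd_twistedBracket,
      hχ, hχ]
    simp only [map_add, map_sub, LinearMap.add_apply]
    -- The mixed brackets come from the induced action, with skewsymmetry when the element of `M` is
    -- on the left. The bracket of two elements of `M` vanishes because `p ∘ i = 0`.
    rw [hdec (X.lcad.bracket (s x.1) (s y.1)), hp, hps, hps, hact, hact, hps, hpi,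
      X.lcad.isLCAd.skew (s y.1) (i x.2), hact, hps, lTensor_adj _ hiD, hω]
    simp only [map_zero, LinearMap.zero_apply, add_zero]
    abel
  have hθ : ∀ x, X.lcad.anchor (χ x) = twistedAnchor L M x := fun x => by
    have h1 : L.anchor (p (χ x)) = X.lcad.anchor (χ x) := X.p.map_anchor (χ x)
    rw [← h1, hpχ]
    rfl
  have hext : DefinesExtension R ω := X.lcad.isLCAd.of_injective χ hbij.1 hχD hB hθ
  refine ⟨ω, hext, { toLinearMap := χ
                     map_D := hχD
                     map_bracket := fun x y => (hB x y).symm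
                     map_anchor := hθ }, hbij, fun m => ?_, hpχ⟩
  change χ (0, m) = i m
  rw [hχ, map_zero, zero_add]

end Classification

end

end ConformalAlgebroid

/-! ### The classification theorem -/

theorem mainTheorem6
    {F : Type*} [Field F] [CharZero F]
    {A : Type*} [CommRing A] [Algebra F A] (δ : Derivation F A A)
    {E : Type*} [AddCommGroup E] [Module F E] [Module A E] [IsScalarTower F A E]
    [ConformalAlgebroid.DiffModule δ E] (L : ConformalAlgebroid.LCAd δ E)
    {M : Type*} [AddCommGroup M] [Module F M] [Module A M] [IsScalarTower F A M]
    [ConformalAlgebroid.DiffModule δ M] (R : ConformalAlgebroid.LCAdModule L M) :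
    -- the maps `ω` that define an extension form a subspace `W`, which is identified with the
    -- space of 2-cocycles by `φ_{λ₁,λ₂}(u, v) = ω_{λ₁}(u, v)`
    ∃ (W : Submodule F (E →ₗ[F] E →ₗ[F] F[X] ⊗[F] M))
      (hW : ∀ ω, ω ∈ W ↔ ConformalAlgebroid.DefinesExtension R ω)
      (Φ : W ≃ₗ[F] ConformalAlgebroid.cocycles R 2),
      (∀ ω : W, (Φ ω).1 = ConformalAlgebroid.toCochain ω.1) ∧
      -- coboundaries are cocycles, and they correspond to the trivial extensions
      ConformalAlgebroid.coboundaries R 2 ≤ ConformalAlgebroid.cocycles R 2 ∧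
      (∀ ω : W, (ConformalAlgebroid.extOf R ω.1 ((hW ω.1).mp ω.2)).IsTrivial ↔
        (Φ ω).1 ∈ ConformalAlgebroid.coboundaries R 2) ∧
      -- the class of a 2-cocycle corresponds to the equivalence class of its extension
      ∃ Ψ : ConformalAlgebroid.cohomology R 2 ≃
          Quotient (ConformalAlgebroid.SplitExt.setoid R),
        ∀ ω : W, Ψ (Submodule.Quotient.mk (Φ ω)) =
          Quotient.mk (ConformalAlgebroid.SplitExt.setoid R)
            (ConformalAlgebroid.extOf R ω.1 ((hW ω.1).mp ω.2)) := by
  -- As the preimage of the cocycles under a linear map, `W` is a subspace without further proof.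
  let W : Submodule F (E →ₗ[F] E →ₗ[F] F[X] ⊗[F] M) :=
    (ConformalAlgebroid.cocycles R 2).comap ConformalAlgebroid.toCochain
  have hW : ∀ ω, ω ∈ W ↔ ConformalAlgebroid.DefinesExtension R ω :=
    ConformalAlgebroid.toCochain_mem_cocycles_iff R
  let Φ : W ≃ₗ[F] ConformalAlgebroid.cocycles R 2 := LinearEquiv.ofBijective
    ((ConformalAlgebroid.toCochain (δ := δ)).restrict fun _ h => h)
    ⟨fun ω η h => Subtype.ext (ConformalAlgebroid.toCochain_injective (congrArg Subtype.val h)),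
      fun φ => by
        obtain ⟨ω, hω⟩ := ConformalAlgebroid.toCochain_surjective φ.1
        exact ⟨⟨ω, by rw [Submodule.mem_comap, hω]; exact φ.2⟩, Subtype.ext hω⟩⟩
  have hΦ : ∀ ω : W, (Φ ω).1 = ConformalAlgebroid.toCochain ω.1 := fun _ => rfl
  -- Both equalities say that `φ^ω - φ^η` is a coboundary. This yields at once that `f` does not
  -- depend on the chosen representatives and that it is injective.
  have hclass : ∀ ω η : W,
      (Submodule.Quotient.mk (Φ ω) : ConformalAlgebroid.cohomology R 2)
        = Submodule.Quotient.mk (Φ η) ↔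
      Quotient.mk (ConformalAlgebroid.SplitExt.setoid R)
          (ConformalAlgebroid.extOf R ω.1 ((hW ω.1).mp ω.2))
        = Quotient.mk (ConformalAlgebroid.SplitExt.setoid R)
          (ConformalAlgebroid.extOf R η.1 ((hW η.1).mp η.2)) := fun ω η => by
    rw [Submodule.Quotient.eq, Quotient.eq, Submodule.submoduleOf, Submodule.mem_comap]
    exact (ConformalAlgebroid.extOf_equivalent_iff R ω.1 η.1 _ _).symm
  have hsurj : Function.Surjective fun ω : W =>
      (Submodule.Quotient.mk (Φ ω) : ConformalAlgebroid.cohomology R 2) :=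
    (Submodule.Quotient.mk_surjective _).comp Φ.surjective
  let f : ConformalAlgebroid.cohomology R 2 → Quotient (ConformalAlgebroid.SplitExt.setoid R) :=
    fun c => Quotient.mk (ConformalAlgebroid.SplitExt.setoid R)
      (ConformalAlgebroid.extOf R (Function.surjInv hsurj c).1
        ((hW _).mp (Function.surjInv hsurj c).2))
  have hf : ∀ ω : W, f (Submodule.Quotient.mk (Φ ω))
      = Quotient.mk (ConformalAlgebroid.SplitExt.setoid R)
        (ConformalAlgebroid.extOf R ω.1 ((hW ω.1).mp ω.2)) := fun ω =>
    (hclass _ _).1 (Function.surjInv_eq hsurj _)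
  refine ⟨W, hW, Φ, hΦ, ConformalAlgebroid.coboundaries_le_cocycles R, fun ω => ?_,
    Equiv.ofBijective f ⟨fun c c' h => ?_, fun X => ?_⟩, hf⟩
  · have h0 := ConformalAlgebroid.definesExtension_zero R
    -- Triviality is the case `η = 0` of the criterion for equivalence.
    have h := ConformalAlgebroid.extOf_equivalent_iff R ω.1 0 ((hW ω.1).mp ω.2) h0
    rw [map_zero, sub_zero] at h
    exact ⟨fun ⟨_, h'⟩ => h.1 h', fun h' => ⟨h0, h.2 h'⟩⟩
  · obtain ⟨ω, rfl⟩ := hsurj c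
    obtain ⟨η, rfl⟩ := hsurj c'
    exact (hclass ω η).2 ((hf ω).symm.trans (h.trans (hf η)))
  · induction X using Quotient.inductionOn with
    | h X =>
      obtain ⟨ω, h, hX⟩ := ConformalAlgebroid.exists_extOf_equivalent R X
      exact ⟨Submodule.Quotient.mk (Φ ⟨ω, (hW ω).2 h⟩),
        (hf ⟨ω, (hW ω).2 h⟩).trans (Quotient.sound hX)⟩
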